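/- For $d\ge 1$ let $L(\mathbb C^d)$ be the class of plurisubharmonic functions $u$ on $\mathbb C^d$ with $u(z)-\log|z|=O(1)$ as $|z|\to\infty$, and for compact $K\subset\mathbb C^d$ let $V_K(z)=\sup\{u(z): u\in L(\mathbb C^d),\ u\le 0 \text{ on } K\}$. Regard $\mathbb R^2\subset\mathbb C^2$, let $$S=\{(x_1,x_2)\in\mathbb R^2:\ x_1^2+x_2^2\le 1,\ x_1x_2\ge 0\}$$ be the union of two quarter disks, and let $h(t)=t+\sqrt{t^2-1}$ for $t\ge 1$ (the Joukowski map). Then for every $z=(z_1,z_2)\in\mathbb C^2$ one has $|1-z_1^2-z_2^2|+|z_1-z_2|^2+2|z_1z_2|\ge 1$ and $$V_S(z_1,z_2)=\tfrac12\log h\bigl(|1-z_1^2-z_2^2|+|z_1-z_2|^2+2|z_1z_2|\bigr).$$ Moreover, let $\Sigma\subset\mathbb R^2\subset\mathbb C^2$ be the convex hull of $(0,0),(0,1),(1,0)$, and let $G:\mathbb C^2\to\mathbb C^2$, $G(z_1,z_2)=((z_1-z_2)^2,\,2z_1z_2)$. Then $G$ is proper, $G^{-1}(\Sigma)=S$,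 and $V_\Sigma(G(z))=2V_S(z)$ for every $z\in\mathbb C^2$. -/

import Mathlib

open MeasureTheory

namespace Pluripotential

noncomputable section

/-- `ℂ^d` with its Euclidean norm. -/
abbrev CSpace (d : ℕ) : Type := EuclideanSpace ℂ (Fin d)

/-- The mean value over the circle `{a + e^{iθ} b : 0 < θ ≤ 2π}` of an extended real function `u`
(mean of the positive part minus mean of the negative part). The first term is finite when `u` is
upper semicontinuous without the value `+∞`; the difference may be `-∞`. -/
def circleMean {d : ℕ} (u : CSpace d → EReal) (a b : CSpace d) : EReal :=
  ((⨍⁻ θ in Set.Ioc (0 : ℝ) (2 * Real.pi),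
      (u (a + Complex.exp (θ * Complex.I) • b)).toENNReal ∂volume : ENNReal) : EReal)
    - ((⨍⁻ θ in Set.Ioc (0 : ℝ) (2 * Real.pi),
      (-u (a + Complex.exp (θ * Complex.I) • b)).toENNReal ∂volume : ENNReal) : EReal)

/-- Plurisubharmonic functions `u : ℂ^d → [-∞, ∞)`: upper semicontinuous, and satisfying the
sub-mean value inequality on every circle of every complex line (the constant `-∞` is allowed). -/
structure IsPSH {d : ℕ} (u : CSpace d → EReal) : Prop where
  lt_top : ∀ z, u z < ⊤
  usc : UpperSemicontinuous u
  submean : ∀ a b : CSpace d, u a ≤ circleMean u a b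

/-- The class `L(ℂ^d)`: plurisubharmonic functions with `u(z) - log |z| = O(1)` as `|z| → ∞`. -/
def classL (d : ℕ) : Set (CSpace d → EReal) :=
  {u | IsPSH u ∧ ∃ C : ℝ, ∀ᶠ z in Bornology.cobounded (CSpace d),
    ((Real.log ‖z‖ - C : ℝ) : EReal) ≤ u z ∧ u z ≤ ((Real.log ‖z‖ + C : ℝ) : EReal)}

/-- The extremal function `V_K(z) = sup {u(z) : u ∈ L(ℂ^d), u ≤ 0 on K}`. -/
def extremalFunction {d : ℕ} (K : Set (CSpace d)) (z : CSpace d) : EReal :=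
  ⨆ u ∈ {u ∈ classL d | ∀ ζ ∈ K, u ζ ≤ 0}, u z

/-- The standard inclusion `ℝ^d ⊂ ℂ^d`. -/
def realInclusion {d : ℕ} (x : EuclideanSpace ℝ (Fin d)) : CSpace d :=
  WithLp.toLp 2 (fun i => (x i : ℂ))

/-- The union of two quarter disks `{x₁² + x₂² ≤ 1, x₁ x₂ ≥ 0} ⊂ ℝ² ⊂ ℂ²`. -/
def quarterDisks : Set (CSpace 2) :=
  realInclusion '' {x | x 0 ^ 2 + x 1 ^ 2 ≤ 1 ∧ 0 ≤ x 0 * x 1}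

/-- The standard triangle `co {(0,0), (0,1), (1,0)} ⊂ ℝ² ⊂ ℂ²`. -/
def standardTriangle : Set (CSpace 2) :=
  realInclusion '' convexHull ℝ {!₂[(0 : ℝ), 0], !₂[(0 : ℝ), 1], !₂[(1 : ℝ), 0]}

/-- The polynomial map `G(z₁, z₂) = ((z₁ - z₂)², 2 z₁ z₂)` of `ℂ²`. -/
def mapG (z : CSpace 2) : CSpace 2 :=
  !₂[(z 0 - z 1) ^ 2, 2 * z 0 * z 1]

/-- The Joukowski map `h(t) = t + √(t² - 1)` on the ray `[1, ∞)`, the only place where it is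
evaluated. -/
def joukowski (t : ℝ) : ℝ := t + Real.sqrt (t ^ 2 - 1)

/-- The argument `|1 - z₁² - z₂²| + |z₁ - z₂|² + 2 |z₁ z₂|` of the Joukowski map. -/
def formulaArg (z : CSpace 2) : ℝ :=
  ‖1 - z 0 ^ 2 - z 1 ^ 2‖ + ‖z 0 - z 1‖ ^ 2 + 2 * ‖z 0 * z 1‖

end

end Pluripotential

namespace Pluripotential

open Filter Topology Asymptotics ComplexConjugate

/-! Both extremal functions arise from one scheme. Let `w j` be finitely many functions that are
quadratic on complex lines and have sum 1, and put φ = ∑ |w j|. The triangle inequality gives φ ≥ 1,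
and φ = 1 exactly where all `w j` are real and nonnegative. For the barycentric coordinates this set
is Σ; for their pullback by G it is S. The claim is that the extremal function of {φ = 1} is s ·
arcosh φ, with s = 1 for Σ and s = 1/2 for S, where arcosh = log h. As φ for S is φ for Σ composed
with G, comparing the two formulas gives the relation between V_Σ and V_S.

Lower bound: s · arcosh φ is itself a competitor. On a complex line the |t|² coefficient of arcosh φ
is nonnegative by Cauchy–Schwarz (`mul_norm_sum_sq_le`); φ need not be smooth, so this is used
through harmonic quadratic lower supports, and a maximum principle turns these into the sub-mean
value inequality (`le_circleAverage_of_harmonicallySupportedAt`).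

Upper bound: equality holds in Cauchy–Schwarz when `w j` has velocity φ `w j` - |`w j`|, so arcosh φ
is harmonic to second order in that direction (`hasJet_arcosh_sum_norm_leaf`). This is an
infinitesimal Monge–Ampère leaf. A competitor u exceeding s · arcosh φ would, after small
perturbations, make the difference attain an interior maximum; along the leaf direction u would then
lie below a strictly superharmonic quadratic, against the sub-mean value inequality
(`le_mul_arcosh_of_ne_zero`). -/

/-! ### Second order expansions on a complex line. -/

/-- The function `g` on `ℂ` has a second order expansion at `0` whose second order part is the real
part of a complex quadratic polynomial plus `κ |t|²`. -/
def HasJet (g : ℂ → ℝ) (α β : ℂ) (κ : ℝ) : Prop :=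
  (fun t => g t - (g 0 + ((α * t + β * t ^ 2).re + κ * ‖t‖ ^ 2))) =o[𝓝 0] fun t => ‖t‖ ^ 2

namespace HasJet

variable {g g₁ g₂ : ℂ → ℝ} {α β α₁ β₁ α₂ β₂ : ℂ} {κ κ₁ κ₂ : ℝ}

theorem of_isLittleO (h : (fun t => g t - (g 0 + ((α * t + β * t ^ 2).re + κ * ‖t‖ ^ 2)))
    =o[𝓝 0] fun t => ‖t‖ ^ 2) : HasJet g α β κ := h

theorem congr_coeff (h : HasJet g α β κ) (hα : α = α₁) (hκ : κ = κ₁) : HasJet g α₁ β κ₁ := by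
  rwa [← hα, ← hκ]

theorem const (c : ℝ) : HasJet (fun _ => c) 0 0 0 := by
  simp [HasJet]

theorem add (h₁ : HasJet g₁ α₁ β₁ κ₁) (h₂ : HasJet g₂ α₂ β₂ κ₂) :
    HasJet (fun t => g₁ t + g₂ t) (α₁ + α₂) (β₁ + β₂) (κ₁ + κ₂) := by
  refine (IsLittleO.add h₁ h₂).congr_left fun t => ?_
  simp only [Complex.add_re, add_mul]
  ring

theorem const_mul (h : HasJet g α β κ) (c : ℝ) :
    HasJet (fun t => c * g t) (c * α) (c * β) (c * κ) := by
  refine (IsLittleO.const_mul_left h c).congr_left fun t => ?_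
  simp only [Complex.add_re, mul_assoc, Complex.re_ofReal_mul]
  ring

theorem sum {ι : Type*} (s : Finset ι) {g : ι → ℂ → ℝ} {α β : ι → ℂ} {κ : ι → ℝ}
    (h : ∀ i ∈ s, HasJet (g i) (α i) (β i) (κ i)) :
    HasJet (fun t => ∑ i ∈ s, g i t) (∑ i ∈ s, α i) (∑ i ∈ s, β i) (∑ i ∈ s, κ i) := by
  classical
  induction s using Finset.induction_on with
  | empty => simpa using const 0
  | insert a s ha ih =>
    simp only [Finset.sum_insert ha]
    exact (h a (by simp)).add (ih fun i hi => h i (by simp [hi]))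

theorem norm_sq_mul (κ : ℝ) : HasJet (fun t => κ * ‖t‖ ^ 2) 0 0 κ := by
  simp [HasJet]

theorem eventually_le (h : HasJet g α β κ) {δ : ℝ} (hδ : 0 < δ) :
    ∀ᶠ t in 𝓝 0, |g t - (g 0 + ((α * t + β * t ^ 2).re + κ * ‖t‖ ^ 2))| ≤ δ * ‖t‖ ^ 2 := by
  filter_upwards [h.bound hδ] with t ht
  simpa using ht

theorem sub_re_linear_isBigO (h : HasJet g α β κ) :
    (fun t => g t - g 0 - (α * t).re) =O[𝓝 0] fun t => ‖t‖ ^ 2 := by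
  have h2 : (fun t : ℂ => (β * t ^ 2).re + κ * ‖t‖ ^ 2) =O[𝓝 0] fun t => ‖t‖ ^ 2 := by
    refine IsBigO.of_bound (‖β‖ + |κ|) (Eventually.of_forall fun t => ?_)
    rw [Real.norm_eq_abs, Real.norm_eq_abs, abs_of_nonneg (sq_nonneg ‖t‖), add_mul]
    refine (abs_add_le _ _).trans (add_le_add ?_ ?_)
    · exact (Complex.abs_re_le_norm _).trans (by simp)
    · simp [abs_mul]
  refine (h.isBigO.add h2).congr_left fun t => ?_
  simp only [Complex.add_re]
  ring

theorem sub_isBigO (h : HasJet g α β κ) : (fun t => g t - g 0) =O[𝓝 0] fun t => ‖t‖ := by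
  have h1 : (fun t : ℂ => ‖t‖ ^ 2) =O[𝓝 0] fun t => ‖t‖ := by
    refine IsBigO.of_bound 1 ?_
    filter_upwards [Metric.ball_mem_nhds (0 : ℂ) one_pos] with t ht
    simp only [Metric.mem_ball, dist_zero_right] at ht
    rw [Real.norm_eq_abs, Real.norm_eq_abs, abs_of_nonneg (by positivity),
      abs_of_nonneg (by positivity)]
    nlinarith [norm_nonneg t]
  have h2 : (fun t : ℂ => (α * t).re) =O[𝓝 0] fun t => ‖t‖ := by
    refine IsBigO.of_bound ‖α‖ (Eventually.of_forall fun t => ?_)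
    rw [Real.norm_eq_abs, Real.norm_eq_abs, abs_norm]
    exact (Complex.abs_re_le_norm _).trans (by simp)
  refine ((h.sub_re_linear_isBigO.trans h1).add h2).congr_left fun t => ?_
  ring

theorem tendsto (h : HasJet g α β κ) : Tendsto g (𝓝 0) (𝓝 (g 0)) := by
  have h1 : Tendsto (fun t : ℂ => ‖t‖) (𝓝 0) (𝓝 0) := by
    simpa using (continuous_norm (E := ℂ)).tendsto 0
  simpa using (h.sub_isBigO.trans_tendsto h1).add_const (g 0)

/-- Chain rule for second order expansions. -/
theorem comp (h : HasJet g α β κ) {f : ℝ → ℝ} {f₁ f₂ : ℝ}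
    (hf : (fun y => f y - (f (g 0) + f₁ * (y - g 0) + f₂ / 2 * (y - g 0) ^ 2))
      =o[𝓝 (g 0)] fun y => (y - g 0) ^ 2) :
    HasJet (fun t => f (g t)) (f₁ * α) (f₁ * β + (f₂ / 4 : ℝ) * α ^ 2)
      (f₁ * κ + f₂ / 4 * ‖α‖ ^ 2) := by
  have e1 : (fun t => f (g t) - (f (g 0) + f₁ * (g t - g 0) + f₂ / 2 * (g t - g 0) ^ 2))
      =o[𝓝 0] fun t => ‖t‖ ^ 2 :=
    (hf.comp_tendsto h.tendsto).trans_isBigO (h.sub_isBigO.pow 2)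
  have e2 : (fun t => (g t - g 0 - (α * t).re) * (g t - g 0 + (α * t).re))
      =o[𝓝 0] fun t : ℂ => ‖t‖ ^ 2 := by
    have h2 : (fun t : ℂ => (α * t).re) =O[𝓝 0] fun t => ‖t‖ := by
      refine IsBigO.of_bound ‖α‖ (Eventually.of_forall fun t => ?_)
      rw [Real.norm_eq_abs, Real.norm_eq_abs, abs_norm]
      exact (Complex.abs_re_le_norm _).trans (by simp)
    have h3 : (fun t : ℂ => ‖t‖) =o[𝓝 0] fun _ => (1 : ℝ) := by
      rw [isLittleO_one_iff]
      simpa using (continuous_norm (E := ℂ)).tendsto 0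
    have := h.sub_re_linear_isBigO.mul_isLittleO ((h.sub_isBigO.add h2).trans_isLittleO h3)
    simpa using this
  refine ((e1.add (h.const_mul_left f₁)).add (e2.const_mul_left (f₂ / 2))).congr_left fun t => ?_
  -- The square of a real linear form is half |α t|² plus a harmonic term: this is how f₂ enters the
  -- |t|² coefficient.
  have key : (α * t).re ^ 2 = 1 / 2 * (‖α‖ ^ 2 * ‖t‖ ^ 2) + 1 / 2 * ((α ^ 2 * t ^ 2).re) := by
    rw [← mul_pow, ← mul_pow, ← norm_mul, ← Complex.normSq_eq_norm_sq, Complex.normSq_apply, sq,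
      sq, Complex.mul_re (α * t) (α * t)]
    ring
  simp only [Complex.add_re, mul_assoc, Complex.re_ofReal_mul, add_mul]
  linear_combination -f₂ / 2 * key

end HasJet

/-- Second order Taylor expansion of a function that is twice differentiable at a point. -/
theorem taylor_two_isLittleO {f f₁ : ℝ → ℝ} {f₂ x : ℝ} (hf : ∀ᶠ y in 𝓝 x, HasDerivAt f (f₁ y) y)
    (hf₁ : HasDerivAt f₁ f₂ x) :
    (fun y => f y - (f x + f₁ x * (y - x) + f₂ / 2 * (y - x) ^ 2)) =o[𝓝 x]
      fun y => (y - x) ^ 2 := by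
  rw [isLittleO_iff]
  intro ε hε
  have h1 := (hasDerivAt_iff_isLittleO.1 hf₁).bound hε
  obtain ⟨r, hr, hb⟩ := Metric.eventually_nhds_iff_ball.1 (hf.and h1)
  filter_upwards [Metric.ball_mem_nhds x hr] with y hy
  -- The remainder has derivative at most ε |y - x| on the ball of radius |y - x|, so the mean value
  -- inequality bounds it by ε |y - x|².
  set F : ℝ → ℝ := fun y => f y - (f x + f₁ x * (y - x) + f₂ / 2 * (y - x) ^ 2) with hF
  have hd : ∀ z ∈ Metric.closedBall x (dist y x),
      HasDerivWithinAt F (f₁ z - f₁ x - (z - x) * f₂) (Metric.closedBall x (dist y x)) z := by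
    intro z hz
    have hz' : z ∈ Metric.ball x r := lt_of_le_of_lt (Metric.mem_closedBall.1 hz) hy
    have h2 : HasDerivAt (fun y => f x + f₁ x * (y - x) + f₂ / 2 * (y - x) ^ 2)
        (f₁ x * 1 + f₂ / 2 * ((2 : ℕ) * (z - x) ^ (2 - 1) * 1)) z :=
      (((((hasDerivAt_id z).sub_const x)).const_mul (f₁ x)).const_add (f x)).add
        ((((hasDerivAt_id z).sub_const x).pow 2).const_mul (f₂ / 2))
    have h3 := ((hb z hz').1.sub h2).hasDerivWithinAt (s := Metric.closedBall x (dist y x))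
    exact h3.congr_deriv (by norm_num; ring)
  have hB : ∀ z ∈ Metric.closedBall x (dist y x), ‖f₁ z - f₁ x - (z - x) * f₂‖ ≤ ε * |y - x| := by
    intro z hz
    have hz' : z ∈ Metric.ball x r := lt_of_le_of_lt (Metric.mem_closedBall.1 hz) hy
    refine ((hb z hz').2).trans ?_
    have : ‖z - x‖ ≤ |y - x| := by simpa [Real.dist_eq] using Metric.mem_closedBall.1 hz
    gcongr
  have := (convex_closedBall x (dist y x)).norm_image_sub_le_of_norm_hasDerivWithin_le hd hB
    (Metric.mem_closedBall_self dist_nonneg) (Metric.mem_closedBall.2 le_rfl)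
  have hFx : F x = 0 := by simp [hF]
  rw [hFx, sub_zero] at this
  refine this.trans (le_of_eq ?_)
  rw [Real.norm_eq_abs, Real.norm_eq_abs, abs_pow]
  ring

theorem hasJet_normSq (w β γ : ℂ) :
    HasJet (fun t => ‖w + β * t + γ * t ^ 2‖ ^ 2) (2 * (conj w * β)) (2 * (conj w * γ))
      (‖β‖ ^ 2) := by
  have h0 : (fun t : ℂ => ‖β + γ * t‖ ^ 2 - ‖β‖ ^ 2) =o[𝓝 0] fun _ => (1 : ℝ) := by
    rw [isLittleO_one_iff]
    have : Continuous fun t : ℂ => ‖β + γ * t‖ ^ 2 - ‖β‖ ^ 2 := by fun_prop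
    simpa using this.tendsto 0
  have h1 := h0.mul_isBigO (isBigO_refl (fun t : ℂ => ‖t‖ ^ 2) (𝓝 0))
  simp only [one_mul] at h1
  refine HasJet.of_isLittleO (h1.congr_left fun t => ?_)
  have e : ∀ a b : ℂ, ‖a + b‖ ^ 2 = ‖a‖ ^ 2 + 2 * (conj a * b).re + ‖b‖ ^ 2 := by
    intro a b
    simp only [← Complex.normSq_eq_norm_sq, Complex.normSq_apply]
    simp
    ring
  have e2 : w + β * t + γ * t ^ 2 = w + (β + γ * t) * t := by ring
  rw [e2, e w, norm_mul, mul_pow]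
  have e3 : 2 * (conj w * β) * t + 2 * (conj w * γ) * t ^ 2 =
      ((2 : ℝ) : ℂ) * (conj w * ((β + γ * t) * t)) := by push_cast; ring
  rw [e3, Complex.re_ofReal_mul]
  simp
  ring

theorem hasJet_norm {w : ℂ} (hw : w ≠ 0) (β γ : ℂ) :
    ∃ b, HasJet (fun t => ‖w + β * t + γ * t ^ 2‖) (conj w * β / ‖w‖) b (‖β‖ ^ 2 / (4 * ‖w‖)) := by
  have hs : 0 < ‖w‖ := norm_pos_iff.2 hw
  have hf : (fun y => Real.sqrt y - (Real.sqrt (‖w‖ ^ 2) + 1 / (2 * Real.sqrt (‖w‖ ^ 2)) *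
      (y - ‖w‖ ^ 2) + (-1 / (4 * ‖w‖ ^ 3)) / 2 * (y - ‖w‖ ^ 2) ^ 2))
      =o[𝓝 (‖w‖ ^ 2)] fun y => (y - ‖w‖ ^ 2) ^ 2 := by
    refine taylor_two_isLittleO (f₁ := fun y => 1 / (2 * Real.sqrt y)) ?_ ?_
    · filter_upwards [lt_mem_nhds (show 0 < ‖w‖ ^ 2 by positivity)] with y hy
      exact Real.hasDerivAt_sqrt hy.ne'
    · have h1 := (Real.hasDerivAt_sqrt (show ‖w‖ ^ 2 ≠ 0 by positivity)).const_mul 2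
      have h2 := (hasDerivAt_const (‖w‖ ^ 2) (1 : ℝ)).div h1 (by positivity)
      refine h2.congr_deriv ?_
      rw [Real.sqrt_sq hs.le]
      field_simp
      ring
  have h := HasJet.comp (g := fun t => ‖w + β * t + γ * t ^ 2‖ ^ 2) (hasJet_normSq w β γ)
    (f := Real.sqrt) (f₁ := 1 / (2 * Real.sqrt (‖w‖ ^ 2))) (f₂ := -1 / (4 * ‖w‖ ^ 3))
    (by simpa using hf)
  simp only [Real.sqrt_sq (norm_nonneg _)] at h
  refine ⟨_, h.congr_coeff ?_ ?_⟩
  · push_cast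
    have : (‖w‖ : ℂ) ≠ 0 := by exact_mod_cast hs.ne'
    field_simp
  · simp only [norm_mul, Complex.norm_conj, RCLike.norm_ofNat]
    field_simp
    ring

/-- The |t|² coefficient vanishes because log |·| of a nonvanishing holomorphic function is
harmonic. Such terms therefore serve as free barriers in the domination principle. -/
theorem hasJet_log_norm {w : ℂ} (hw : w ≠ 0) (β γ : ℂ) :
    ∃ a b, HasJet (fun t => Real.log ‖w + β * t + γ * t ^ 2‖) a b 0 := by
  have hs : 0 < ‖w‖ := norm_pos_iff.2 hw
  have hf : (fun y => Real.log y - (Real.log (‖w‖ ^ 2) + (‖w‖ ^ 2)⁻¹ *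
      (y - ‖w‖ ^ 2) + (-((‖w‖ ^ 2) ^ 2)⁻¹) / 2 * (y - ‖w‖ ^ 2) ^ 2))
      =o[𝓝 (‖w‖ ^ 2)] fun y => (y - ‖w‖ ^ 2) ^ 2 := by
    refine taylor_two_isLittleO (f₁ := fun y => y⁻¹) ?_ ?_
    · filter_upwards [lt_mem_nhds (show 0 < ‖w‖ ^ 2 by positivity)] with y hy
      exact Real.hasDerivAt_log hy.ne'
    · exact hasDerivAt_inv (by positivity)
  have h := HasJet.comp (g := fun t => ‖w + β * t + γ * t ^ 2‖ ^ 2) (hasJet_normSq w β γ)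
    (f := Real.log) (f₁ := (‖w‖ ^ 2)⁻¹) (f₂ := -((‖w‖ ^ 2) ^ 2)⁻¹)
    (by simpa using hf)
  have h2 := h.const_mul (1 / 2)
  simp only [Real.log_pow] at h2
  have e : ∀ t : ℂ, 1 / 2 * (((2 : ℕ) : ℝ) * Real.log ‖w + β * t + γ * t ^ 2‖) =
      Real.log ‖w + β * t + γ * t ^ 2‖ := fun t => by push_cast; ring
  simp only [e] at h2
  refine ⟨_, _, h2.congr_coeff rfl ?_⟩
  · simp only [norm_mul, Complex.norm_conj, RCLike.norm_ofNat]
    field_simp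
    ring

theorem arcosh_taylor {x : ℝ} (hx : 1 < x) :
    (fun y => Real.arcosh y - (Real.arcosh x + (Real.sqrt (x ^ 2 - 1))⁻¹ * (y - x) +
      (-x / (Real.sqrt (x ^ 2 - 1)) ^ 3) / 2 * (y - x) ^ 2)) =o[𝓝 x] fun y => (y - x) ^ 2 := by
  have h0 : 0 < x ^ 2 - 1 := by nlinarith
  refine taylor_two_isLittleO (f₁ := fun y => (Real.sqrt (y ^ 2 - 1))⁻¹) ?_ ?_
  · filter_upwards [lt_mem_nhds hx] with y hy
    exact Real.hasDerivAt_arcosh hy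
  · have h1 : HasDerivAt (fun y : ℝ => y ^ 2 - 1) (2 * x) x := by
      simpa using (hasDerivAt_pow 2 x).sub_const 1
    have h2 := (h1.sqrt h0.ne').inv (Real.sqrt_pos.2 h0).ne'
    refine h2.congr_deriv ?_
    have := Real.sqrt_pos.2 h0
    field_simp

theorem HasJet.arcosh {g : ℂ → ℝ} {α β : ℂ} {κ : ℝ} (h : HasJet g α β κ) (hg : 1 < g 0) :
    ∃ a b, HasJet (fun t => Real.arcosh (g t)) a b
      ((κ - g 0 * ‖α‖ ^ 2 / (4 * (g 0 ^ 2 - 1))) / Real.sqrt (g 0 ^ 2 - 1)) := by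
  have h0 : 0 < g 0 ^ 2 - 1 := by nlinarith
  refine ⟨_, _, (h.comp (arcosh_taylor hg)).congr_coeff rfl ?_⟩
  have h1 := Real.sqrt_pos.2 h0
  have h2 := Real.sq_sqrt h0.le
  set s := Real.sqrt (g 0 ^ 2 - 1)
  rw [← h2]
  field_simp
  ring

theorem hasJet_re_polynomial (p : Polynomial ℂ) (a : ℂ) :
    ∃ α β, HasJet (fun t => (p.eval (a + t)).re) α β 0 := by
  have hd : ∀ q : Polynomial ℂ, ∀ t, q.eval t = q.divX.eval t * t + q.coeff 0 := by
    intro q t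
    conv_lhs => rw [← q.divX_mul_X_add]
    simp
  set q := p.comp (Polynomial.C a + Polynomial.X) with hq
  have hq' : ∀ t, p.eval (a + t) = q.eval t := fun t => by simp [hq]
  refine ⟨q.divX.coeff 0, q.divX.divX.coeff 0, HasJet.of_isLittleO ?_⟩
  have h0 : (fun t : ℂ => (q.divX.divX.divX.eval t * t).re) =O[𝓝 0] fun t => t :=
    ((isBigO_of_le _ fun t => Complex.abs_re_le_norm _).trans
      ((q.divX.divX.divX.continuous.tendsto 0).isBigO_one ℂ |>.mul (isBigO_refl _ _))).trans
      (by simpa using isBigO_refl _ _)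
  have h1 : (fun t : ℂ => ‖q.divX.divX.divX.eval t * t‖) =o[𝓝 0] fun _ => (1 : ℝ) := by
    rw [isLittleO_one_iff]
    have : Continuous fun t : ℂ => ‖q.divX.divX.divX.eval t * t‖ := by fun_prop
    simpa using this.tendsto 0
  have h2 := h1.mul_isBigO (isBigO_refl (fun t : ℂ => ‖t‖ ^ 2) (𝓝 0))
  simp only [one_mul] at h2
  refine IsBigO.trans_isLittleO (IsBigO.of_bound 1 (Eventually.of_forall fun t => ?_)) h2
  rw [hq' t, hq' 0, hd q t, hd q.divX t, hd q.divX.divX t, hd q 0, one_mul, norm_mul, norm_norm,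
    ← norm_pow, norm_norm, ← norm_mul, Real.norm_eq_abs]
  refine le_trans (le_of_eq ?_) (Complex.abs_re_le_norm _)
  congr 1
  rw [mul_zero, zero_add, zero_mul, add_zero, ← Complex.add_re, ← Complex.sub_re]
  congr 1
  ring

/-! ### Harmonic lower supports and the sub-mean value inequality. -/

/-- Summing over the four points ±r/2, ±ir/2 cancels the linear and the quadratic harmonic terms. -/
theorem nonpos_of_eventually_re_add_le {A B : ℂ} {δ : ℝ}
    (h : ∀ᶠ t : ℂ in 𝓝 0, (A * t + B * t ^ 2).re + δ * ‖t‖ ^ 2 ≤ 0) : δ ≤ 0 := by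
  obtain ⟨r, hr, hb⟩ := Metric.eventually_nhds_iff_ball.1 h
  have hs : ∀ c : ℂ, ‖c‖ = 1 → c * ((r / 2 : ℝ) : ℂ) ∈ Metric.ball (0 : ℂ) r := by
    intro c hc
    rw [mem_ball_zero_iff, norm_mul, hc, one_mul, Complex.norm_real, Real.norm_eq_abs,
      abs_of_pos (by positivity)]
    linarith
  have e : ∀ c : ℂ, ‖c‖ = 1 → (A * (c * ((r / 2 : ℝ) : ℂ)) + B * (c * ((r / 2 : ℝ) : ℂ)) ^ 2).re
      + δ * (r / 2) ^ 2 ≤ 0 := by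
    intro c hc
    have := hb _ (hs c hc)
    rwa [norm_mul, hc, one_mul, Complex.norm_real, Real.norm_eq_abs,
      abs_of_pos (by positivity)] at this
  have h1 := e 1 (by simp)
  have h2 := e (-1) (by simp)
  have h3 := e Complex.I (by simp)
  have h4 := e (-Complex.I) (by simp)
  have hz : (A * (1 * ((r / 2 : ℝ) : ℂ)) + B * (1 * ((r / 2 : ℝ) : ℂ)) ^ 2) +
      (A * (-1 * ((r / 2 : ℝ) : ℂ)) + B * (-1 * ((r / 2 : ℝ) : ℂ)) ^ 2) +
      (A * (Complex.I * ((r / 2 : ℝ) : ℂ)) + B * (Complex.I * ((r / 2 : ℝ) : ℂ)) ^ 2) +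
      (A * (-Complex.I * ((r / 2 : ℝ) : ℂ)) + B * (-Complex.I * ((r / 2 : ℝ) : ℂ)) ^ 2) = 0 := by
    linear_combination 2 * B * ((r / 2 : ℝ) : ℂ) ^ 2 * Complex.I_sq
  have hz' := congrArg Complex.re hz
  rw [Complex.add_re, Complex.add_re, Complex.add_re, Complex.zero_re] at hz'
  have h5 : δ * (r / 2) ^ 2 ≤ 0 := by linarith
  exact nonpos_of_mul_nonpos_left h5 (by positivity)

/-- A real function on `ℂ` that at `a` is bounded below, up to `o(|t|²)`, by the real part of a
quadratic polynomial agreeing with it at `a`. -/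
def HarmonicallySupportedAt (g : ℂ → ℝ) (a : ℂ) : Prop :=
  ∀ δ > 0, ∃ α β : ℂ, ∀ᶠ t in 𝓝 0, g a + (α * t + β * t ^ 2).re - δ * ‖t‖ ^ 2 ≤ g (a + t)

theorem HasJet.harmonicallySupportedAt {g f : ℂ → ℝ} {a α β : ℂ} {κ : ℝ} (h : HasJet f α β κ)
    (hκ : 0 ≤ κ) (h0 : f 0 = g a) (hfg : ∀ᶠ t in 𝓝 0, f t ≤ g (a + t)) :
    HarmonicallySupportedAt g a := by
  intro δ hδ
  refine ⟨α, β, ?_⟩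
  filter_upwards [h.eventually_le hδ, hfg] with t ht ht'
  have := (abs_le.1 ht).1
  have h2 : 0 ≤ κ * ‖t‖ ^ 2 := by positivity
  linarith

/-- A maximum principle. If the bound failed inside, adding a small δ |t|² would still leave an
interior maximum of g - Re p; the lower support of g there would have a positive |t|² term, which
the four-point cancellation forbids. -/
theorem le_re_polynomial_of_le_on_circle {g : ℂ → ℝ} (hg : Continuous g)
    (h : ∀ a, HarmonicallySupportedAt g a) (p : Polynomial ℂ) (ε : ℝ)
    (hp : ∀ t : ℂ, ‖t‖ = 1 → g t ≤ (p.eval t).re + ε) {t₀ : ℂ} (ht₀ : ‖t₀‖ ≤ 1) :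
    g t₀ ≤ (p.eval t₀).re + ε := by
  by_contra! hlt
  obtain ⟨δ, hδ, hδ'⟩ : ∃ δ > 0, δ < g t₀ - (p.eval t₀).re - ε :=
    exists_between (by linarith)
  set F : ℂ → ℝ := fun t => g t - (p.eval t).re + δ * ‖t‖ ^ 2 with hF
  have hFc : Continuous F := by
    have := Complex.continuous_re.comp p.continuous
    simp only [Function.comp_def] at this
    fun_prop
  obtain ⟨a, ha, hmax⟩ := (isCompact_closedBall (0 : ℂ) 1).exists_isMaxOn ⟨0, by simp⟩
    hFc.continuousOn
  have hFa : δ + ε < F a := by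
    have h1 : F t₀ ≤ F a := hmax (by simpa using ht₀)
    have h2 : 0 ≤ δ * ‖t₀‖ ^ 2 := by positivity
    simp only [hF] at h1 ⊢
    linarith
  have ha' : ‖a‖ < 1 := by
    refine lt_of_le_of_ne (by simpa using ha) fun h1 => ?_
    have := hp a h1
    simp only [hF, h1] at hFa
    linarith
  obtain ⟨α, β, h1⟩ := h a (δ / 4) (by positivity)
  obtain ⟨α', β', h2⟩ := hasJet_re_polynomial p a
  have h3 := h2.eventually_le (show 0 < δ / 4 by positivity)
  have h4 : ∀ᶠ t in 𝓝 (0 : ℂ), F (a + t) ≤ F a := by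
    have : ∀ᶠ t in 𝓝 (0 : ℂ), a + t ∈ Metric.ball (0 : ℂ) 1 := by
      have hc : Continuous fun t : ℂ => a + t := by fun_prop
      exact hc.continuousAt.eventually_mem (Metric.isOpen_ball.mem_nhds (by simpa using ha'))
    filter_upwards [this] with t ht
    exact hmax (Metric.ball_subset_closedBall ht)
  have h5 : ∀ᶠ t : ℂ in 𝓝 0, ((α - α' + 2 * δ * conj a) * t + (β - β') * t ^ 2).re
      + δ / 2 * ‖t‖ ^ 2 ≤ 0 := by
    filter_upwards [h1, h3, h4] with t k1 k3 k4
    have k3' := (abs_le.1 k3).2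
    simp only [hF, add_zero, zero_mul] at k3' k4
    have e : ‖a + t‖ ^ 2 = ‖a‖ ^ 2 + 2 * (conj a * t).re + ‖t‖ ^ 2 := by
      simp only [← Complex.normSq_eq_norm_sq, Complex.normSq_apply]
      simp
      ring
    have e2 : ((α - α' + 2 * δ * conj a) * t + (β - β') * t ^ 2).re =
        (α * t + β * t ^ 2).re - (α' * t + β' * t ^ 2).re + 2 * δ * (conj a * t).re := by
      have : (α - α' + 2 * δ * conj a) * t + (β - β') * t ^ 2 =
        (α * t + β * t ^ 2) - (α' * t + β' * t ^ 2) + ((2 * δ : ℝ) : ℂ) * (conj a * t) := by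
        push_cast; ring
      rw [this, Complex.add_re, Complex.sub_re, Complex.re_ofReal_mul]
    rw [e] at k4
    rw [e2]
    linarith
  linarith [nonpos_of_eventually_re_add_le h5]

/-- Trigonometric polynomials are dense on the circle, and the real part of each is there the real
part of a polynomial. -/
theorem exists_polynomial_re_approx {g : ℂ → ℝ} (hg : Continuous g) {ε : ℝ} (hε : 0 < ε) :
    ∃ p : Polynomial ℂ, ∀ t : ℂ, ‖t‖ = 1 → |g t - (p.eval t).re| ≤ ε := by
  have : Fact (0 < 2 * Real.pi) := ⟨Real.two_pi_pos⟩
  let f : C(AddCircle (2 * Real.pi), ℂ) :=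
    ⟨fun x => (g (fourier 1 x) : ℂ), by fun_prop⟩
  have hf : f ∈ (Submodule.span ℂ (Set.range (@fourier (2 * Real.pi)))).topologicalClosure := by
    rw [span_fourier_closure_eq_top]; trivial
  obtain ⟨q, hq, hqd⟩ := Metric.mem_closure_iff.1 hf ε hε
  have hpow : ∀ (m : ℕ) (x : AddCircle (2 * Real.pi)),
      (fourier (m : ℤ) x : ℂ) = (fourier 1 x : ℂ) ^ m := by
    intro m x
    induction m with
    | zero => simp
    | succ m ih => rw [Nat.cast_succ, fourier_add, ih, pow_succ]
  have key : ∀ q ∈ Submodule.span ℂ (Set.range (@fourier (2 * Real.pi))), ∀ c : ℂ,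
      ∃ p : Polynomial ℂ, ∀ x, (c * q x).re = (p.eval ((fourier 1 x : ℂ))).re := by
    intro q hq
    induction hq using Submodule.span_induction with
    | mem q hq =>
      obtain ⟨n, rfl⟩ := hq
      intro c
      rcases Int.eq_nat_or_neg n with ⟨m, rfl | rfl⟩
      · refine ⟨Polynomial.C c * Polynomial.X ^ m, fun x => ?_⟩
        rw [hpow, Polynomial.eval_mul, Polynomial.eval_C, Polynomial.eval_pow, Polynomial.eval_X]
      -- A negative frequency is conjugated into a positive one, which does not change the real
      -- part.
      · refine ⟨Polynomial.C (conj c) * Polynomial.X ^ m, fun x => ?_⟩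
        rw [← Complex.conj_re, fourier_neg, hpow, map_mul, Complex.conj_conj, Polynomial.eval_mul,
          Polynomial.eval_C, Polynomial.eval_pow, Polynomial.eval_X]
    | zero => exact fun c => ⟨0, by simp⟩
    | add q₁ q₂ _ _ h₁ h₂ =>
      intro c
      obtain ⟨p₁, hp₁⟩ := h₁ c
      obtain ⟨p₂, hp₂⟩ := h₂ c
      exact ⟨p₁ + p₂, fun x => by
        rw [ContinuousMap.add_apply, mul_add, Complex.add_re, hp₁, hp₂, Polynomial.eval_add,
          Complex.add_re]⟩
    | smul d q _ h =>
      intro c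
      obtain ⟨p, hp⟩ := h (c * d)
      exact ⟨p, fun x => by rw [← hp]; simp [mul_assoc, -Complex.mul_re]⟩
  obtain ⟨p, hp⟩ := key q hq 1
  refine ⟨p, fun t ht => ?_⟩
  obtain ⟨x, hx⟩ : ∃ x : AddCircle (2 * Real.pi), (fourier 1 x : ℂ) = t := by
    obtain ⟨x, hx⟩ := (AddCircle.homeomorphCircle Real.two_pi_pos.ne').surjective
      (⟨t, mem_sphere_zero_iff_norm.2 ht⟩ : Circle)
    refine ⟨x, ?_⟩
    rw [fourier_one, ← AddCircle.homeomorphCircle_apply Real.two_pi_pos.ne', hx]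
  have h1 := (ContinuousMap.dist_apply_le_dist (f := f) (g := q) x).trans hqd.le
  rw [Complex.dist_eq] at h1
  refine le_trans (le_of_eq ?_) ((Complex.abs_re_le_norm _).trans h1)
  have h2 := hp x
  rw [hx, one_mul] at h2
  rw [Complex.sub_re, h2, ← hx]
  rfl

theorem circleAverage_re_polynomial (p : Polynomial ℂ) :
    Real.circleAverage (fun t => (p.eval t).re) 0 1 = (p.eval 0).re := by
  have hp' : Real.circleAverage (fun t => p.eval t) 0 1 = p.eval 0 :=
    circleAverage_of_differentiable_on_off_countable Set.countable_empty
      p.continuous.continuousOn fun z _ => p.differentiableAt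
  rw [← hp']
  exact Complex.reCLM.circleAverage_comp_comm p.continuous.continuousOn.circleIntegrable'

theorem le_circleAverage_of_harmonicallySupportedAt {g : ℂ → ℝ} (hg : Continuous g)
    (h : ∀ a, HarmonicallySupportedAt g a) : g 0 ≤ Real.circleAverage g 0 1 := by
  refine le_of_forall_pos_le_add fun ε hε => ?_
  obtain ⟨p, hp⟩ := exists_polynomial_re_approx hg (half_pos hε)
  have h1 : g 0 ≤ (p.eval 0).re + ε / 2 := by
    refine le_re_polynomial_of_le_on_circle hg h p _ (fun t ht => ?_) (by simp)
    linarith [(abs_le.1 (hp t ht)).2]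
  have hpc : Continuous fun t => (p.eval t).re := Complex.continuous_re.comp p.continuous
  have h2 : Real.circleAverage (fun t => (p.eval t).re) 0 1 = (p.eval 0).re :=
    circleAverage_re_polynomial p
  have h3 : Real.circleAverage (fun t => (p.eval t).re) 0 1 ≤
      Real.circleAverage (fun t => g t + ε / 2) 0 1 := by
    refine Real.circleAverage_mono hpc.continuousOn.circleIntegrable'
      (hg.add continuous_const).continuousOn.circleIntegrable' fun t ht => ?_
    have : ‖t‖ = 1 := by simpa using ht
    linarith [(abs_le.1 (hp t this)).1]
  have h4 : Real.circleAverage (fun t => g t + ε / 2) 0 1 = Real.circleAverage g 0 1 + ε / 2 := by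
    rw [Real.circleAverage_fun_add hg.continuousOn.circleIntegrable'
      continuousOn_const.circleIntegrable', Real.circleAverage_const]
  linarith

/-! ### Circle means of extended real functions. -/

theorem lintegral_pos_sub_lintegral_neg {ν : Measure ℝ} {f : ℝ → ℝ} (hf : Integrable f ν) :
    ((∫⁻ θ, ((f θ : EReal)).toENNReal ∂ν : ENNReal) : EReal)
      - ((∫⁻ θ, (-(f θ : EReal)).toENNReal ∂ν : ENNReal) : EReal) = ((∫ θ, f θ ∂ν : ℝ) : EReal) := by
  have e : ∀ x : ℝ, (x : EReal).toENNReal = ENNReal.ofReal x := fun x => by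
    rw [EReal.toENNReal_of_ne_top (EReal.coe_ne_top x), EReal.toReal_coe]
  have e' : ∀ x : ℝ, (-(x : EReal)).toENNReal = ENNReal.ofReal (-x) := fun x => by
    rw [← EReal.coe_neg, e]
  simp only [e, e']
  have hp := hf.lintegral_lt_top.ne
  have hn : ∫⁻ θ, ENNReal.ofReal (-f θ) ∂ν ≠ ⊤ := hf.neg.lintegral_lt_top.ne
  rw [integral_eq_lintegral_pos_part_sub_lintegral_neg_part hf, EReal.coe_sub,
    EReal.coe_ennreal_toReal hp, EReal.coe_ennreal_toReal hn]

theorem laverage_pos_sub_laverage_neg {g : ℂ → ℝ} (hg : Continuous g) :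
    ((⨍⁻ θ in Set.Ioc (0 : ℝ) (2 * Real.pi),
        (g (Complex.exp (θ * Complex.I)) : EReal).toENNReal ∂volume : ENNReal) : EReal)
      - ((⨍⁻ θ in Set.Ioc (0 : ℝ) (2 * Real.pi),
        (-(g (Complex.exp (θ * Complex.I)) : EReal)).toENNReal ∂volume : ENNReal) : EReal) =
      ((Real.circleAverage g 0 1 : ℝ) : EReal) := by
  have hc : Continuous fun θ : ℝ => g (Complex.exp (θ * Complex.I)) := by fun_prop
  have hi : Integrable (fun θ : ℝ => g (Complex.exp (θ * Complex.I)))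
      (volume.restrict (Set.Ioc 0 (2 * Real.pi))) := hc.integrableOn_Ioc
  have hi' := hi.to_average
  rw [laverage, laverage, lintegral_pos_sub_lintegral_neg hi',
    Real.circleAverage_eq_intervalAverage, Set.uIoc_of_le Real.two_pi_pos.le, average]
  simp [circleMap]

theorem circleMean_le {d : ℕ} {u : CSpace d → EReal} {a b : CSpace d} {g : ℂ → ℝ}
    (hg : Continuous g) (h : ∀ t : ℂ, ‖t‖ = 1 → u (a + t • b) ≤ (g t : EReal)) :
    circleMean u a b ≤ ((Real.circleAverage g 0 1 : ℝ) : EReal) := by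
  have h' : ∀ θ : ℝ, u (a + Complex.exp (θ * Complex.I) • b) ≤
      (g (Complex.exp (θ * Complex.I)) : EReal) := fun θ => h _ (Complex.norm_exp_ofReal_mul_I θ)
  rw [← laverage_pos_sub_laverage_neg hg, circleMean]
  refine EReal.sub_le_sub ?_ ?_
  · rw [EReal.coe_ennreal_le_coe_ennreal_iff]
    exact lintegral_mono fun θ => EReal.toENNReal_le_toENNReal (h' θ)
  · rw [EReal.coe_ennreal_le_coe_ennreal_iff]
    exact lintegral_mono fun θ => EReal.toENNReal_le_toENNReal (EReal.neg_le_neg_iff.2 (h' θ))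

theorem circleMean_coe {d : ℕ} {W : CSpace d → ℝ} (hW : Continuous W) (a b : CSpace d) :
    circleMean (fun z => (W z : EReal)) a b =
      ((Real.circleAverage (fun t => W (a + t • b)) 0 1 : ℝ) : EReal) :=
  laverage_pos_sub_laverage_neg (g := fun t => W (a + t • b)) (by fun_prop)

theorem HarmonicallySupportedAt.const_mul {g : ℂ → ℝ} {a : ℂ} (h : HarmonicallySupportedAt g a)
    {s : ℝ} (hs : 0 < s) : HarmonicallySupportedAt (fun t => s * g t) a := by
  intro δ hδ
  obtain ⟨α, β, hb⟩ := h (δ / s) (by positivity)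
  refine ⟨s * α, s * β, ?_⟩
  filter_upwards [hb] with t ht
  have h1 := mul_le_mul_of_nonneg_left ht hs.le
  have e : ((s : ℂ) * α * t + s * β * t ^ 2).re = s * (α * t + β * t ^ 2).re := by
    rw [← Complex.re_ofReal_mul]; congr 1; ring
  have e2 : s * (g a + (α * t + β * t ^ 2).re - δ / s * ‖t‖ ^ 2) =
      s * g a + s * (α * t + β * t ^ 2).re - δ * ‖t‖ ^ 2 := by
    field_simp
  rw [e]
  linarith

/-! ### The |t|² coefficient of arcosh (∑ |w j|). -/

section Expansion

variable {ι : Type*} {s : Finset ι} {w β γ : ι → ℂ}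

theorem hasJet_sum_norm (hw : ∀ j ∈ s, w j ≠ 0) (β γ : ι → ℂ) :
    ∃ b, HasJet (fun t => ∑ j ∈ s, ‖w j + β j * t + γ j * t ^ 2‖)
      (∑ j ∈ s, conj (w j) * β j / ‖w j‖) b (∑ j ∈ s, ‖β j‖ ^ 2 / (4 * ‖w j‖)) := by
  have : ∀ j, ∃ b, j ∈ s → HasJet (fun t => ‖w j + β j * t + γ j * t ^ 2‖)
      (conj (w j) * β j / ‖w j‖) b (‖β j‖ ^ 2 / (4 * ‖w j‖)) := fun j => by
    by_cases hj : j ∈ s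
    · obtain ⟨b, hb⟩ := hasJet_norm (hw j hj) (β j) (γ j)
      exact ⟨b, fun _ => hb⟩
    · exact ⟨0, fun h => absurd h hj⟩
  choose b hb using this
  exact ⟨_, HasJet.sum s hb⟩

/-- In the direction `φ wⱼ - |wⱼ|` the function `arcosh (∑ |wⱼ|)` is harmonic to second order. -/
theorem hasJet_arcosh_sum_norm_leaf (hw : ∀ j ∈ s, w j ≠ 0) (hsum : ∑ j ∈ s, w j = 1)
    (hφ : 1 < ∑ j ∈ s, ‖w j‖) (hβ : ∀ j ∈ s, β j = (∑ i ∈ s, ‖w i‖ : ℝ) * w j - ‖w j‖)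
    (γ : ι → ℂ) :
    ∃ a b, HasJet (fun t => Real.arcosh (∑ j ∈ s, ‖w j + β j * t + γ j * t ^ 2‖)) a b 0 := by
  obtain ⟨b, hb⟩ := hasJet_sum_norm hw β γ
  obtain ⟨a', b', h⟩ := hb.arcosh (by simpa using hφ)
  refine ⟨a', b', h.congr_coeff rfl ?_⟩
  set φ := ∑ j ∈ s, ‖w j‖ with hφ'
  -- With α = φ² - 1 and κ = φ (φ² - 1)/4, the two terms of the coefficient in `HasJet.arcosh`
  -- cancel.
  have hα : ∑ j ∈ s, conj (w j) * β j / ‖w j‖ = ((φ ^ 2 - 1 : ℝ) : ℂ) := by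
    have : ∀ j ∈ s, conj (w j) * β j / ‖w j‖ = (φ : ℂ) * ‖w j‖ - conj (w j) := by
      intro j hj
      have h0 : (‖w j‖ : ℂ) ≠ 0 := by exact_mod_cast norm_ne_zero_iff.2 (hw j hj)
      rw [hβ j hj, div_eq_iff h0]
      linear_combination (φ : ℂ) * Complex.conj_mul' (w j)
    rw [Finset.sum_congr rfl this, Finset.sum_sub_distrib, ← Finset.mul_sum, ← map_sum, hsum,
      ← Complex.ofReal_sum, ← hφ']
    push_cast
    simp
    ring
  have hκ : ∑ j ∈ s, ‖β j‖ ^ 2 / (4 * ‖w j‖) = φ * (φ ^ 2 - 1) / 4 := by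
    have : ∀ j ∈ s, ‖β j‖ ^ 2 / (4 * ‖w j‖) =
        ((φ ^ 2 + 1) / 4) * ‖w j‖ - φ / 2 * (w j).re := by
      intro j hj
      have h0 : ‖w j‖ ≠ 0 := norm_ne_zero_iff.2 (hw j hj)
      have h1 : ‖β j‖ ^ 2 = φ ^ 2 * ‖w j‖ ^ 2 - 2 * φ * ‖w j‖ * (w j).re + ‖w j‖ ^ 2 := by
        rw [hβ j hj, ← Complex.normSq_eq_norm_sq, Complex.normSq_apply]
        have := Complex.normSq_eq_norm_sq (w j)
        rw [Complex.normSq_apply] at this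
        simp
        linear_combination φ ^ 2 * this
      rw [h1]
      field_simp
      ring
    have hre : ∑ j ∈ s, (w j).re = 1 := by rw [← Complex.re_sum, hsum, Complex.one_re]
    rw [Finset.sum_congr rfl this, Finset.sum_sub_distrib, ← Finset.mul_sum, ← Finset.mul_sum,
      hre, ← hφ']
    ring
  have h1 : 0 < φ ^ 2 - 1 := by nlinarith
  have h0 : ∑ j ∈ s, ‖w j + β j * 0 + γ j * 0 ^ 2‖ = φ := by simp [hφ']
  rw [h0, hα, hκ, Complex.norm_real, Real.norm_eq_abs, abs_of_pos h1]
  field_simp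
  ring

/-- Since ∑ β j = 0, the constant 1/φ may be subtracted from the phases before weighted
Cauchy–Schwarz; the first factor then becomes (φ² - 1)/φ. Equality holds for β j = φ w j - |w j|. -/
theorem mul_norm_sum_sq_le (hw : ∀ j ∈ s, w j ≠ 0) (hsum : ∑ j ∈ s, w j = 1)
    (hβ : ∑ j ∈ s, β j = 0) :
    (∑ j ∈ s, ‖w j‖) * ‖∑ j ∈ s, conj (w j) * β j / ‖w j‖‖ ^ 2 ≤
      ((∑ j ∈ s, ‖w j‖) ^ 2 - 1) * ∑ j ∈ s, ‖β j‖ ^ 2 / ‖w j‖ := by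
  set φ := ∑ j ∈ s, ‖w j‖ with hφ'
  have hφ : 1 ≤ φ := by
    have := norm_sum_le s w
    rwa [hsum, norm_one] at this
  have hφ0 : φ ≠ 0 := by positivity
  have e : ∑ j ∈ s, conj (w j) * β j / ‖w j‖ =
      ∑ j ∈ s, (conj (w j) / ‖w j‖ - (φ : ℂ)⁻¹) * β j := by
    simp only [sub_mul, Finset.sum_sub_distrib, ← Finset.mul_sum, hβ, mul_zero, sub_zero]
    exact Finset.sum_congr rfl fun j _ => by ring
  have h1 : ‖∑ j ∈ s, conj (w j) * β j / ‖w j‖‖ ≤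
      ∑ j ∈ s, ‖conj (w j) / ‖w j‖ - (φ : ℂ)⁻¹‖ * ‖β j‖ := by
    rw [e]
    exact (norm_sum_le _ _).trans (le_of_eq (Finset.sum_congr rfl fun j _ => norm_mul _ _))
  have h2 : (∑ j ∈ s, ‖conj (w j) / ‖w j‖ - (φ : ℂ)⁻¹‖ * ‖β j‖) ^ 2 ≤
      (∑ j ∈ s, ‖w j‖ * ‖conj (w j) / ‖w j‖ - (φ : ℂ)⁻¹‖ ^ 2) * ∑ j ∈ s, ‖β j‖ ^ 2 / ‖w j‖ := by
    refine Finset.sum_sq_le_sum_mul_sum_of_sq_le_mul s (fun j _ => by positivity)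
      (fun j _ => by positivity) fun j hj => le_of_eq ?_
    have h0 : ‖w j‖ ≠ 0 := norm_ne_zero_iff.2 (hw j hj)
    field_simp
  have h3 : ∑ j ∈ s, ‖w j‖ * ‖conj (w j) / ‖w j‖ - (φ : ℂ)⁻¹‖ ^ 2 = (φ ^ 2 - 1) / φ := by
    have : ∀ j ∈ s, ‖w j‖ * ‖conj (w j) / ‖w j‖ - (φ : ℂ)⁻¹‖ ^ 2 =
        (1 + (φ ^ 2)⁻¹) * ‖w j‖ - 2 / φ * (w j).re := by
      intro j hj
      have h0 : ‖w j‖ ≠ 0 := norm_ne_zero_iff.2 (hw j hj)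
      have h4 : ‖conj (w j) / ‖w j‖ - (φ : ℂ)⁻¹‖ ^ 2 = 1 + (φ ^ 2)⁻¹ - 2 / φ * ((w j).re / ‖w j‖) := by
        have := Complex.normSq_eq_norm_sq (w j)
        rw [Complex.normSq_apply] at this
        rw [← Complex.ofReal_inv, ← Complex.normSq_eq_norm_sq, Complex.normSq_apply,
          Complex.sub_re, Complex.sub_im, Complex.div_ofReal_re, Complex.div_ofReal_im,
          Complex.conj_re, Complex.conj_im, Complex.ofReal_re, Complex.ofReal_im]
        field_simp
        linear_combination φ ^ 2 * this
      rw [h4]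
      field_simp
    have hre : ∑ j ∈ s, (w j).re = 1 := by rw [← Complex.re_sum, hsum, Complex.one_re]
    rw [Finset.sum_congr rfl this, Finset.sum_sub_distrib, ← Finset.mul_sum, ← Finset.mul_sum,
      hre, ← hφ']
    field_simp
    ring
  have h5 := (pow_le_pow_left₀ (norm_nonneg _) h1 2).trans h2
  rw [h3] at h5
  calc φ * _ ≤ φ * ((φ ^ 2 - 1) / φ * ∑ j ∈ s, ‖β j‖ ^ 2 / ‖w j‖) := by gcongr
    _ = _ := by field_simp

/-- Where φ = 1, arcosh φ has its minimum. Elsewhere the vanishing `w k` are the only obstruction to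
smoothness: such a term with β k ≠ 0 grows like |t| and helps, and if all those β k vanish,
Cauchy–Schwarz over the remaining indices suffices. -/
theorem harmonicallySupportedAt_arcosh_sum_norm [Fintype ι] {g : ℂ → ℝ} {a : ℂ}
    (hsum : ∑ j, w j = 1) (hβ : ∑ j, β j = 0) (hγ : ∑ j, γ j = 0)
    (hg : ∀ t, g (a + t) = Real.arcosh (∑ j, ‖w j + β j * t + γ j * t ^ 2‖)) :
    HarmonicallySupportedAt g a := by
  classical
  have hga : g a = Real.arcosh (∑ j, ‖w j‖) := by simpa using hg 0
  have hge : ∀ t, 1 ≤ ∑ j, ‖w j + β j * t + γ j * t ^ 2‖ := by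
    intro t
    have h1 : ∑ j, (w j + β j * t + γ j * t ^ 2) = 1 := by
      simp [Finset.sum_add_distrib, ← Finset.sum_mul, hsum, hβ, hγ]
    have := norm_sum_le Finset.univ fun j => w j + β j * t + γ j * t ^ 2
    rwa [h1, norm_one] at this
  have hφ : 1 ≤ ∑ j, ‖w j‖ := by simpa using hge 0
  rcases hφ.eq_or_lt with hφ | hφ
  · intro δ hδ
    refine ⟨0, 0, Eventually.of_forall fun t => ?_⟩
    rw [hga, ← hφ, hg t]
    have := Real.arcosh_nonneg (hge t)
    have h2 : 0 ≤ δ * ‖t‖ ^ 2 := by positivity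
    simp
    linarith
  set J := Finset.univ.filter fun j => w j ≠ 0 with hJ
  have hwJ : ∀ j ∈ J, w j ≠ 0 := fun j hj => (Finset.mem_filter.1 hj).2
  have hsJ : ∑ j ∈ J, ‖w j‖ = ∑ j, ‖w j‖ :=
    Finset.sum_subset (Finset.subset_univ _) fun j _ hj => by simpa [hJ] using hj
  obtain ⟨b, hb⟩ := hasJet_sum_norm hwJ β γ
  have hle : ∃ M ≥ (0 : ℝ), (∀ᶠ t in 𝓝 (0 : ℂ), ∑ j ∈ J, ‖w j + β j * t + γ j * t ^ 2‖
      + M * ‖t‖ ^ 2 ≤ ∑ j, ‖w j + β j * t + γ j * t ^ 2‖) ∧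
      (∑ j, ‖w j‖) * ‖∑ j ∈ J, conj (w j) * β j / ‖w j‖‖ ^ 2 / (4 * ((∑ j, ‖w j‖) ^ 2 - 1)) ≤
        ∑ j ∈ J, ‖β j‖ ^ 2 / (4 * ‖w j‖) + M := by
    have hpos : 0 < (∑ j, ‖w j‖) ^ 2 - 1 := by nlinarith
    by_cases hk : ∃ k, w k = 0 ∧ β k ≠ 0
    · obtain ⟨k, hk, hβk⟩ := hk
      have hkJ : k ∉ J := by simp [hJ, hk]
      -- M is the amount that makes the |t|² coefficient of the arcosh nonnegative; near 0 the
      -- linear growth of |w k| exceeds M |t|².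
      set M := (∑ j, ‖w j‖) * ‖∑ j ∈ J, conj (w j) * β j / ‖w j‖‖ ^ 2 /
        (4 * ((∑ j, ‖w j‖) ^ 2 - 1)) with hM
      have hM0 : 0 ≤ M := by positivity
      refine ⟨M, hM0, ?_, le_add_of_nonneg_left (Finset.sum_nonneg fun j _ => by positivity)⟩
      have hev : ∀ᶠ t in 𝓝 (0 : ℂ), (M + ‖γ k‖) * ‖t‖ < ‖β k‖ := by
        have hc : Continuous fun t : ℂ => (M + ‖γ k‖) * ‖t‖ := by fun_prop
        refine hc.continuousAt.eventually_lt continuousAt_const ?_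
        simpa using hβk
      filter_upwards [hev] with t ht
      have h1 : M * ‖t‖ ^ 2 ≤ ‖w k + β k * t + γ k * t ^ 2‖ := by
        have e : w k + β k * t + γ k * t ^ 2 = (β k + γ k * t) * t := by rw [hk]; ring
        have h2 : ‖β k‖ - ‖γ k‖ * ‖t‖ ≤ ‖β k + γ k * t‖ := by
          rw [← norm_mul]; exact norm_sub_le_norm_add _ _
        rw [e, norm_mul, sq, ← mul_assoc]
        refine mul_le_mul_of_nonneg_right ?_ (norm_nonneg t)
        nlinarith
      calc _ ≤ ∑ j ∈ J, ‖w j + β j * t + γ j * t ^ 2‖ + ‖w k + β k * t + γ k * t ^ 2‖ := by gcongr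
        _ = ∑ j ∈ insert k J, ‖w j + β j * t + γ j * t ^ 2‖ := by
          rw [Finset.sum_insert hkJ, add_comm]
        _ ≤ _ := Finset.sum_le_univ_sum_of_nonneg fun j => norm_nonneg _
    · push Not at hk
      refine ⟨0, le_rfl, Eventually.of_forall fun t => ?_, ?_⟩
      · rw [zero_mul, add_zero]
        exact Finset.sum_le_univ_sum_of_nonneg fun j => norm_nonneg _
      · have h1 := mul_norm_sum_sq_le (β := β) hwJ
          ((Finset.sum_subset (Finset.subset_univ _) fun j _ hj => by simpa [hJ] using hj).trans hsum)
          ((Finset.sum_subset (Finset.subset_univ _) fun j _ hj =>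
            hk j (by simpa [hJ] using hj)).trans hβ)
        rw [hsJ] at h1
        have e : ∑ j ∈ J, ‖β j‖ ^ 2 / (4 * ‖w j‖) = (∑ j ∈ J, ‖β j‖ ^ 2 / ‖w j‖) / 4 := by
          rw [Finset.sum_div]
          exact Finset.sum_congr rfl fun j _ => by rw [div_div, mul_comm]
        rw [add_zero, e, div_le_div_iff₀ (by positivity) (by positivity)]
        linarith
  obtain ⟨M, hM, hev, hκ⟩ := hle
  have hjet := hb.add (HasJet.norm_sq_mul M)
  have h0 : ∑ j ∈ J, ‖w j + β j * 0 + γ j * 0 ^ 2‖ + M * ‖(0 : ℂ)‖ ^ 2 = ∑ j, ‖w j‖ := by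
    simp [hsJ]
  obtain ⟨a', b', h⟩ := hjet.arcosh (by rw [h0]; exact hφ)
  refine h.harmonicallySupportedAt ?_ (by rw [h0, hga]) ?_
  · refine div_nonneg ?_ (Real.sqrt_nonneg _)
    rw [h0, add_zero]
    linarith
  · have hpos := hjet.tendsto
    rw [h0] at hpos
    filter_upwards [hev, hpos.eventually (lt_mem_nhds (zero_lt_one.trans hφ))] with t h1 h2
    rw [hg t]
    exact (Real.arcosh_le_arcosh h2 (h2.trans_le h1)).2 h1

end Expansion

/-! ### The domination principle and the extremal function of {φ = 1}. -/

section Domination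

variable {d : ℕ} {ι : Type*} [Fintype ι]

/-- On a small circle of radius σ the majorant has mean r - κ σ², below the value r at the centre.
-/
theorem IsPSH.not_eventually_le {u : CSpace d → EReal} (hu : IsPSH u) {z b : CSpace d} {r κ : ℝ}
    (hr : u z = r) (hκ : 0 < κ) {α β : ℂ} :
    ¬ ∀ᶠ t : ℂ in 𝓝 0, u (z + t • b) ≤ ((r + (α * t + β * t ^ 2).re - κ * ‖t‖ ^ 2 : ℝ) : EReal) := by
  intro h
  obtain ⟨ρ, hρ, hb⟩ := Metric.eventually_nhds_iff_ball.1 h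
  set σ := ρ / 2 with hσ
  have hσ0 : 0 < σ := by positivity
  let p : Polynomial ℂ := Polynomial.C ((r - κ * σ ^ 2 : ℝ) : ℂ) +
    Polynomial.C (α * σ) * Polynomial.X + Polynomial.C (β * σ ^ 2) * Polynomial.X ^ 2
  have h1 : circleMean u z ((σ : ℂ) • b) ≤
      ((Real.circleAverage (fun t => (p.eval t).re) 0 1 : ℝ) : EReal) := by
    refine circleMean_le (Complex.continuous_re.comp p.continuous) fun t ht => ?_
    have hn : ‖t * σ‖ = σ := by
      rw [norm_mul, ht, one_mul, Complex.norm_real, Real.norm_eq_abs, abs_of_pos hσ0]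
    have hball : t * σ ∈ Metric.ball (0 : ℂ) ρ := by
      rw [mem_ball_zero_iff, hn]; linarith
    have h2 := hb _ hball
    rw [smul_smul]
    refine h2.trans (le_of_eq ?_)
    rw [hn]
    congr 1
    have e : p.eval t = ((r - κ * σ ^ 2 : ℝ) : ℂ) + (α * (t * σ) + β * (t * σ) ^ 2) := by
      simp [p]
      ring
    have e' := congrArg Complex.re e
    rw [Complex.add_re, Complex.ofReal_re] at e'
    rw [e']
    ring
  have h2 := (hu.submean z ((σ : ℂ) • b)).trans h1
  rw [circleAverage_re_polynomial, hr, EReal.coe_le_coe_iff] at h2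
  simp [p, -Complex.ofReal_sub, -Complex.ofReal_mul, -Complex.ofReal_pow] at h2
  nlinarith [mul_pos hκ (pow_pos hσ0 2)]

/-- Small circles avoid the centre, so a bound by a continuous function at generic points passes to
every point. -/
theorem IsPSH.le_of_eventually_le {u : CSpace d → EReal} (hu : IsPSH u) {W : CSpace d → ℝ}
    (hW : Continuous W) {z b : CSpace d}
    (h : ∀ᶠ t : ℂ in 𝓝[≠] 0, u (z + t • b) ≤ W (z + t • b)) : u z ≤ W z := by
  refine EReal.le_of_forall_lt_iff_le.1 fun c hc => ?_
  rw [EReal.coe_lt_coe_iff] at hc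
  have hWc : ContinuousAt (fun t : ℂ => W (z + t • b)) 0 := by fun_prop
  have h1 : ∀ᶠ t : ℂ in 𝓝[≠] 0, W (z + t • b) < c :=
    (hWc.eventually_lt continuousAt_const (by simpa using hc)).filter_mono nhdsWithin_le_nhds
  obtain ⟨ρ, hρ, hb⟩ := Metric.mem_nhdsWithin_iff.1 (h.and h1)
  have hσ0 : 0 < ρ / 2 := by positivity
  have h2 : circleMean u z (((ρ / 2 : ℝ) : ℂ) • b) ≤
      ((Real.circleAverage (fun _ => c) 0 1 : ℝ) : EReal) := by
    refine circleMean_le continuous_const fun t ht => ?_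
    have hn : ‖t * ((ρ / 2 : ℝ) : ℂ)‖ = ρ / 2 := by
      rw [norm_mul, ht, one_mul, Complex.norm_real, Real.norm_eq_abs, abs_of_pos hσ0]
    have h3 := hb (a := t * ((ρ / 2 : ℝ) : ℂ)) ⟨by rw [mem_ball_zero_iff, hn]; linarith, by
      rw [Set.mem_compl_singleton_iff, ← norm_ne_zero_iff, hn]; exact hσ0.ne'⟩
    rw [smul_smul]
    exact h3.1.trans (EReal.coe_le_coe_iff.2 h3.2.le)
  rw [Real.circleAverage_const] at h2
  exact (hu.submean z _).trans h2

/-- A family of functions on `ℂ^d` that are quadratic on complex lines and add up to `1`. -/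
structure IsQuadraticPartition (w : ι → CSpace d → ℂ) : Prop where
  continuous : ∀ j, Continuous (w j)
  sum_eq_one : ∀ z, ∑ j, w j z = 1
  quadratic : ∀ z b, ∃ β γ : ι → ℂ, ∀ j t, w j (z + t • b) = w j z + β j * t + γ j * t ^ 2

/-- The sum of the moduli of a family of functions. -/
noncomputable def totalNorm (w : ι → CSpace d → ℂ) (z : CSpace d) : ℝ := ∑ j, ‖w j z‖

namespace IsQuadraticPartition

variable {w : ι → CSpace d → ℂ}

theorem one_le_totalNorm (hw : IsQuadraticPartition w) (z : CSpace d) : 1 ≤ totalNorm w z := by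
  have := norm_sum_le Finset.univ fun j => w j z
  rwa [hw.sum_eq_one, norm_one] at this

theorem continuous_totalNorm (hw : IsQuadraticPartition w) : Continuous (totalNorm w) :=
  continuous_finsetSum _ fun j _ => (hw.continuous j).norm

theorem continuous_arcosh (hw : IsQuadraticPartition w) :
    Continuous fun z => Real.arcosh (totalNorm w z) :=
  Real.continuousOn_arcosh.comp_continuous hw.continuous_totalNorm fun z => hw.one_le_totalNorm z

theorem isPSH_mul_arcosh (hw : IsQuadraticPartition w) {s : ℝ} (hs : 0 < s) :
    IsPSH fun z => ((s * Real.arcosh (totalNorm w z) : ℝ) : EReal) where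
  lt_top z := EReal.coe_lt_top _
  usc := (continuous_coe_real_ereal.comp
    (continuous_const.mul hw.continuous_arcosh)).upperSemicontinuous
  submean a b := by
    have hc : Continuous fun z => s * Real.arcosh (totalNorm w z) :=
      continuous_const.mul hw.continuous_arcosh
    rw [circleMean_coe hc, EReal.coe_le_coe_iff]
    have h := le_circleAverage_of_harmonicallySupportedAt
      (g := fun t => s * Real.arcosh (totalNorm w (a + t • b)))
      (hc.comp (by fun_prop : Continuous fun t : ℂ => a + t • b)) fun t₀ => by
        obtain ⟨β, γ, h⟩ := hw.quadratic (a + t₀ • b) b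
        have h0 : ∀ t : ℂ, (∑ j, β j) * t + (∑ j, γ j) * t ^ 2 = 0 := by
          intro t
          have h1 := hw.sum_eq_one (a + t₀ • b + t • b)
          simp only [h, Finset.sum_add_distrib, ← Finset.sum_mul, hw.sum_eq_one] at h1
          linear_combination h1
        refine HarmonicallySupportedAt.const_mul
          (harmonicallySupportedAt_arcosh_sum_norm (w := fun j => w j (a + t₀ • b))
            (β := β) (γ := γ) (hw.sum_eq_one _) ?_ ?_ fun t => ?_) hs
        · linear_combination (h0 1 - h0 (-1)) / 2
        · linear_combination (h0 1 + h0 (-1)) / 2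
        · simp only [totalNorm, ← h, add_smul, add_assoc]
    simpa using h

/-- The domination principle off the zeros of `w` and `e`. -/
theorem le_mul_arcosh_of_ne_zero (hw : IsQuadraticPartition w) {s : ℝ}
    {e : CSpace d → ℂ} (hec : Continuous e) (hele : ∀ z, ‖e z‖ ≤ totalNorm w z)
    (heq : ∀ z b, ∃ β γ : ℂ, ∀ t : ℂ, e (z + t • b) = e z + β * t + γ * t ^ 2)
    (hleaf : ∀ z, (∀ j, w j z ≠ 0) → e z ≠ 0 → ∃ b, ∃ γ : ι → ℂ, ∀ j t,
      w j (z + t • b) = w j z + (totalNorm w z * w j z - ‖w j z‖) * t + γ j * t ^ 2)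
    {u : CSpace d → EReal} (hu : IsPSH u) (hu0 : ∀ z, totalNorm w z = 1 → u z ≤ 0)
    {C : ℝ} (hC : ∀ᶠ z in Bornology.cobounded (CSpace d),
      u z ≤ ((s * Real.arcosh (totalNorm w z) + C : ℝ) : EReal))
    (htop : Tendsto (fun z => Real.arcosh (totalNorm w z)) (Bornology.cobounded (CSpace d)) atTop)
    {z₀ : CSpace d} (hz₀ : ∀ j, w j z₀ ≠ 0) (hez₀ : e z₀ ≠ 0) :
    u z₀ ≤ ((s * Real.arcosh (totalNorm w z₀) : ℝ) : EReal) := by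
  set A : CSpace d → ℝ := fun z => Real.arcosh (totalNorm w z) with hA
  have hA0 : ∀ z, 0 ≤ A z := fun z => Real.arcosh_nonneg (hw.one_le_totalNorm z)
  -- One unit for each `w j` and one for `e`: each logarithm in L is at most A, so L ≤ m A.
  set m : ℝ := Fintype.card ι + 1 with hm
  set L : CSpace d → ℝ := fun z => ∑ j, Real.log ‖w j z‖ + Real.log ‖e z‖ with hL
  have hlog : ∀ x z, 0 ≤ x → x ≤ totalNorm w z → Real.log x ≤ A z := by
    intro x z hx hxz
    have h1 := hw.one_le_totalNorm z
    rcases hx.eq_or_lt with rfl | hx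
    · simpa using hA0 z
    · refine Real.log_le_log hx (hxz.trans ?_)
      exact le_add_of_nonneg_right (Real.sqrt_nonneg _)
  have hLA : ∀ z, L z ≤ m * A z := by
    intro z
    have h1 : ∑ j, Real.log ‖w j z‖ ≤ ∑ _j : ι, A z := Finset.sum_le_sum fun j _ =>
      hlog _ z (norm_nonneg _) (Finset.single_le_sum (f := fun j => ‖w j z‖)
        (fun i _ => norm_nonneg _) (Finset.mem_univ j))
    rw [Finset.sum_const, Finset.card_univ, nsmul_eq_mul] at h1
    have h2 := hlog _ z (norm_nonneg _) (hele z)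
    simp only [hL, hm, add_mul, one_mul]
    exact add_le_add h1 h2
  -- L is -∞ on the exceptional zeros and keeps the maximum away from them. The weight m + 1 instead
  -- of m leaves a spare -ε A, which absorbs the constant C far out.
  have key : ∀ ε > 0, u z₀ + ((ε * L z₀ - (s + ε * (m + 1)) * A z₀ : ℝ) : EReal) ≤ 0 := by
    intro ε hε
    by_contra! hpos
    obtain ⟨η, hη0, hη⟩ := EReal.lt_iff_exists_real_btwn.1 hpos
    have hη0 : 0 < η := by exact_mod_cast hη0
    obtain ⟨ρ₀, hρ₀⟩ : ∃ ρ₀ : ℝ, ∀ z : CSpace d, ρ₀ ≤ ‖z‖ →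
        u z ≤ ((s * A z + C : ℝ) : EReal) ∧ C / ε ≤ A z := by
      have h1 := hC.and (htop.eventually_ge_atTop (C / ε))
      obtain ⟨ρ₀, _, h2⟩ := (Filter.HasBasis.eventually_iff
        (Filter.hasBasis_cobounded_norm (E := CSpace d))).1 h1
      exact ⟨ρ₀, fun z hz => h2 hz⟩
    -- On the sphere of radius ρ one has C ≤ ε A; δ is so small that δ |z|² stays below η in the
    -- ball, so the maximum is interior.
    set ρ := max ρ₀ (max ‖z₀‖ 1) with hρ
    have hρ1 : 1 ≤ ρ := (le_max_right _ _).trans (le_max_right _ _)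
    set δ := η / ρ ^ 2 / 2 with hδ
    have hδ0 : 0 < δ := by positivity
    have hδρ : δ * ρ ^ 2 < η := by
      rw [hδ]; field_simp; linarith
    set R : CSpace d → ℝ := fun z => ε * L z - (s + ε * (m + 1)) * A z + δ * ‖z‖ ^ 2 with hR
    have hRle : ∀ z, R z ≤ -(s + ε) * A z + δ * ‖z‖ ^ 2 := by
      intro z
      have := mul_le_mul_of_nonneg_left (hLA z) hε.le
      simp only [hR]
      linarith
    set good : CSpace d → Prop := fun z => (∀ j, w j z ≠ 0) ∧ e z ≠ 0 with hgood
    -- The continuous extension of R with value -∞ at the zeros, which makes u + G upper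
    -- semicontinuous on the whole ball.
    set G : CSpace d → EReal := fun z => ENNReal.log (ENNReal.ofReal
      (((∏ j, ‖w j z‖) * ‖e z‖) ^ ε * Real.exp (-(s + ε * (m + 1)) * A z + δ * ‖z‖ ^ 2))) with hG
    have hGc : Continuous G := by
      have h1 : Continuous fun z => ((∏ j, ‖w j z‖) * ‖e z‖) ^ ε :=
        ((continuous_finsetProd _ fun j _ => (hw.continuous j).norm).mul hec.norm).rpow_const
          fun z => Or.inr hε.le
      have h2 : Continuous A := hw.continuous_arcosh
      exact ENNReal.continuous_log.comp (ENNReal.continuous_ofReal.comp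
        (h1.mul (Real.continuous_exp.comp (by fun_prop))))
    have hGgood : ∀ z, good z → G z = R z := by
      intro z hz
      have h1 : 0 < ∏ j, ‖w j z‖ := Finset.prod_pos fun j _ => norm_pos_iff.2 (hz.1 j)
      have h2 : 0 < ‖e z‖ := norm_pos_iff.2 hz.2
      have h3 : 0 < (∏ j, ‖w j z‖) * ‖e z‖ := mul_pos h1 h2
      simp only [hG, hR, hL]
      rw [ENNReal.log_ofReal_of_pos (by positivity), EReal.coe_eq_coe_iff,
        Real.log_mul (by positivity) (by positivity), Real.log_exp, Real.log_rpow h3,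
        Real.log_mul h1.ne' h2.ne', Real.log_prod fun j _ => norm_ne_zero_iff.2 (hz.1 j)]
      ring
    have hGbad : ∀ z, ¬ good z → G z = ⊥ := by
      intro z hz
      have h1 : (∏ j, ‖w j z‖) * ‖e z‖ = 0 := by
        by_contra h
        refine hz ⟨fun j hj => h ?_, fun he => h (by simp [he])⟩
        rw [Finset.prod_eq_zero (Finset.mem_univ j) (by simp [hj]), zero_mul]
      simp only [hG, h1, Real.zero_rpow hε.ne', zero_mul, ENNReal.ofReal_zero, ENNReal.log_zero]
    have hGtop : ∀ z, G z ≠ ⊤ := by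
      intro z
      by_cases hz : good z
      · rw [hGgood z hz]; exact EReal.coe_ne_top _
      · rw [hGbad z hz]; exact bot_ne_top
    have husc : UpperSemicontinuous fun z => u z + G z :=
      hu.usc.add' hGc.upperSemicontinuous fun z =>
        EReal.continuousAt_add (Or.inl (hu.lt_top z).ne) (Or.inr (hGtop z))
    have hz₀mem : z₀ ∈ Metric.closedBall (0 : CSpace d) ρ := by
      rw [mem_closedBall_zero_iff]
      exact (le_max_left _ _).trans (le_max_right _ _)
    obtain ⟨a, ha, hmax⟩ := (husc.upperSemicontinuousOn _).exists_isMaxOn ⟨z₀, hz₀mem⟩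
      (isCompact_closedBall (0 : CSpace d) ρ)
    have hηa : (η : EReal) < u a + G a := by
      refine (hη.trans_le ?_).trans_le (hmax hz₀mem)
      beta_reduce
      rw [hGgood z₀ ⟨hz₀, hez₀⟩]
      refine add_le_add le_rfl (EReal.coe_le_coe_iff.2 ?_)
      simp only [hR]
      have : 0 ≤ δ * ‖z₀‖ ^ 2 := by positivity
      linarith
    have hagood : good a := by
      by_contra h
      rw [hGbad a h, EReal.add_bot] at hηa
      exact not_lt_bot hηa
    rw [hGgood a hagood] at hηa
    have haρ : ‖a‖ ≤ ρ := by simpa using ha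
    have hδa : δ * ‖a‖ ^ 2 ≤ δ * ρ ^ 2 := by gcongr
    have hbot : u a ≠ ⊥ := by
      intro h
      rw [h, EReal.bot_add] at hηa
      exact not_lt_bot hηa
    obtain ⟨r, hr⟩ : ∃ r : ℝ, u a = r := ⟨_, (EReal.coe_toReal (hu.lt_top a).ne hbot).symm⟩
    rw [hr, ← EReal.coe_add, EReal.coe_lt_coe_iff] at hηa
    have haφ : 1 < totalNorm w a := by
      refine lt_of_le_of_ne (hw.one_le_totalNorm a) fun h => ?_
      have h1 := hu0 a h.symm
      rw [hr] at h1
      have h1' : r ≤ 0 := by exact_mod_cast h1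
      have h2 := hRle a
      have h3 : A a = 0 := by simp [hA, ← h]
      rw [h3] at h2
      linarith
    have haρ' : ‖a‖ < ρ := by
      refine lt_of_le_of_ne haρ fun h => ?_
      obtain ⟨h1, h2⟩ := hρ₀ a (by rw [h]; exact le_max_left _ _)
      rw [hr, EReal.coe_le_coe_iff] at h1
      have h3 := hRle a
      rw [div_le_iff₀ hε] at h2
      linarith
    obtain ⟨b, γ, hbγ⟩ := hleaf a hagood.1 hagood.2
    -- If b = 0, then φ w j = |w j| for all j; taking norms and summing gives φ² = φ, against φ > 1.
    have hb : b ≠ 0 := by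
      rintro rfl
      refine haφ.ne' ?_
      have h1 : ∀ j, (totalNorm w a : ℂ) * w j a = ‖w j a‖ := by
        intro j
        have h2 := hbγ j 1
        have h3 := hbγ j (-1)
        rw [smul_zero, add_zero] at h2 h3
        linear_combination (h3 - h2) / 2
      have h2 : totalNorm w a * totalNorm w a = totalNorm w a := by
        nth_rw 2 3 [totalNorm]
        rw [Finset.mul_sum]
        refine Finset.sum_congr rfl fun j _ => ?_
        have h3 := congrArg norm (h1 j)
        rwa [norm_mul, Complex.norm_real, Complex.norm_real, norm_norm, Real.norm_eq_abs,
          abs_of_pos (zero_lt_one.trans haφ)] at h3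
      exact mul_right_cancel₀ (zero_lt_one.trans haφ).ne' (by rw [h2, one_mul])
    have hκ : 0 < δ * ‖b‖ ^ 2 := by
      have := norm_pos_iff.2 hb
      positivity
    -- Along the leaf direction A and the logarithms are harmonic to second order, so only δ |z|²
    -- contributes.
    obtain ⟨α, β, hjet⟩ : ∃ α β, HasJet (fun t : ℂ => R (a + t • b)) α β (δ * ‖b‖ ^ 2) := by
      obtain ⟨α₁, β₁, h1⟩ := hasJet_arcosh_sum_norm_leaf (s := Finset.univ)
        (w := fun j => w j a) (fun j _ => hagood.1 j) (hw.sum_eq_one a) haφ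
        (β := fun j => totalNorm w a * w j a - ‖w j a‖) (fun j _ => rfl) γ
      have h1' : HasJet (fun t : ℂ => A (a + t • b)) α₁ β₁ 0 := by
        simpa only [hA, totalNorm, hbγ] using h1
      have h2 : ∀ j, ∃ α β, HasJet (fun t : ℂ => Real.log ‖w j (a + t • b)‖) α β 0 := fun j => by
        simp only [hbγ]
        exact hasJet_log_norm (hagood.1 j) _ _
      choose α₂ β₂ h2 using h2
      obtain ⟨α₃, β₃, h3⟩ : ∃ α β, HasJet (fun t : ℂ => Real.log ‖e (a + t • b)‖) α β 0 := by
        obtain ⟨β, γ, h⟩ := heq a b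
        simp only [h]
        exact hasJet_log_norm hagood.2 _ _
      have h4 : HasJet (fun t : ℂ => ‖a + t • b‖ ^ 2) (2 * inner ℂ a b) 0 (‖b‖ ^ 2) := by
        refine HasJet.of_isLittleO (IsLittleO.of_bound fun c hc => Eventually.of_forall fun t => ?_)
        have e1 : ‖a + t • b‖ ^ 2 = ‖a‖ ^ 2 + 2 * (inner ℂ a b * t).re + ‖t‖ ^ 2 * ‖b‖ ^ 2 := by
          rw [norm_add_sq (𝕜 := ℂ), inner_smul_right, norm_smul, mul_pow, mul_comm t]
          rfl
        have e2 : (2 * inner ℂ a b * t + 0 * t ^ 2 : ℂ).re = 2 * (inner ℂ a b * t).re := by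
          rw [zero_mul, add_zero, mul_assoc]
          exact Complex.re_ofReal_mul 2 _
        rw [e1, e2, zero_smul, add_zero]
        have e3 : ‖a‖ ^ 2 + 2 * (inner ℂ a b * t).re + ‖t‖ ^ 2 * ‖b‖ ^ 2 -
            (‖a‖ ^ 2 + (2 * (inner ℂ a b * t).re + ‖b‖ ^ 2 * ‖t‖ ^ 2)) = 0 := by ring
        rw [e3, norm_zero]
        positivity
      have h5 := ((((HasJet.sum Finset.univ fun j _ => h2 j).add h3).const_mul ε).add
        (h1'.const_mul (-(s + ε * (m + 1))))).add (h4.const_mul δ)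
      have e4 : (fun t : ℂ => R (a + t • b)) = fun t => ε * (∑ j, Real.log ‖w j (a + t • b)‖ +
          Real.log ‖e (a + t • b)‖) + -(s + ε * (m + 1)) * A (a + t • b) +
          δ * ‖a + t • b‖ ^ 2 := by
        ext t
        simp only [hR, hL]
        ring
      rw [e4]
      exact ⟨_, _, h5.congr_coeff rfl (by simp)⟩
    have hcont : Continuous fun t : ℂ => a + t • b := by fun_prop
    have hev1 : ∀ᶠ t : ℂ in 𝓝 0, a + t • b ∈ Metric.ball (0 : CSpace d) ρ :=
      hcont.continuousAt.eventually_mem (Metric.isOpen_ball.mem_nhds (by simpa using haρ'))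
    have hev2 : ∀ᶠ t : ℂ in 𝓝 0, good (a + t • b) := by
      have h1 : ∀ f : CSpace d → ℂ, Continuous f → f a ≠ 0 → ∀ᶠ t : ℂ in 𝓝 0, f (a + t • b) ≠ 0 :=
        fun f hf hfa => (hf.comp hcont).continuousAt.eventually_ne (by simpa using hfa)
      exact (eventually_all.2 fun j => h1 _ (hw.continuous j) (hagood.1 j)).and
        (h1 e hec hagood.2)
    refine hu.not_eventually_le (b := b) (α := -α) (β := -β) hr (half_pos hκ) ?_
    filter_upwards [hev1, hev2, hjet.eventually_le (half_pos hκ)] with t h1 h2 h3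
    have h4 := hmax (Metric.ball_subset_closedBall h1)
    simp only [Set.mem_ofPred_eq, hGgood _ h2, hGgood _ hagood, hr] at h4
    rw [← EReal.coe_add] at h4
    have h5 := (abs_le.1 h3).1
    have h6 : u (a + t • b) ≤ ((r + R a - R (a + t • b) : ℝ) : EReal) := by
      rw [EReal.coe_sub]
      exact EReal.le_sub_iff_add_le (Or.inl (EReal.coe_ne_bot _)) (Or.inl (EReal.coe_ne_top _)) |>.2 h4
    refine h6.trans (EReal.coe_le_coe_iff.2 ?_)
    have e1 : (-α * t + -β * t ^ 2).re = -(α * t + β * t ^ 2).re := by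
      rw [← Complex.neg_re]; congr 1; ring
    rw [e1]
    simp only [zero_smul, add_zero] at h5
    linarith
  by_cases hbot : u z₀ = ⊥
  · rw [hbot]; exact bot_le
  obtain ⟨r, hr⟩ : ∃ r : ℝ, u z₀ = r := ⟨_, (EReal.coe_toReal (hu.lt_top z₀).ne hbot).symm⟩
  rw [hr, EReal.coe_le_coe_iff]
  have key' : ∀ ε > 0, r - s * A z₀ ≤ ε * ((m + 1) * A z₀ - L z₀) := by
    intro ε hε
    have := key ε hε
    rw [hr, ← EReal.coe_add] at this
    have : r + (ε * L z₀ - (s + ε * (m + 1)) * A z₀) ≤ 0 := by exact_mod_cast this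
    linarith
  have hD : 0 ≤ (m + 1) * A z₀ - L z₀ := by linarith [hLA z₀, hA0 z₀]
  -- Since L z₀ is finite at a generic point, ε → 0 removes the barrier.
  refine le_of_forall_pos_le_add fun ε hε => ?_
  have h1 := key' (ε / ((m + 1) * A z₀ - L z₀ + 1)) (by positivity)
  have h2 : ε / ((m + 1) * A z₀ - L z₀ + 1) * ((m + 1) * A z₀ - L z₀) ≤ ε := by
    rw [div_mul_eq_mul_div, div_le_iff₀ (by positivity)]
    nlinarith
  linarith

theorem extremalFunction_eq (hw : IsQuadraticPartition w) {s : ℝ} (hs : 0 < s)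
    {e : CSpace d → ℂ} (hec : Continuous e) (hele : ∀ z, ‖e z‖ ≤ totalNorm w z)
    (heq : ∀ z b, ∃ β γ : ℂ, ∀ t : ℂ, e (z + t • b) = e z + β * t + γ * t ^ 2)
    (hleaf : ∀ z, (∀ j, w j z ≠ 0) → e z ≠ 0 → ∃ b, ∃ γ : ι → ℂ, ∀ j t,
      w j (z + t • b) = w j z + (totalNorm w z * w j z - ‖w j z‖) * t + γ j * t ^ 2)
    (hgen : ∀ z, ∃ b, ∀ᶠ t : ℂ in 𝓝[≠] 0, (∀ j, w j (z + t • b) ≠ 0) ∧ e (z + t • b) ≠ 0)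
    {C : ℝ} (hC : ∀ᶠ z in Bornology.cobounded (CSpace d),
      |s * Real.arcosh (totalNorm w z) - Real.log ‖z‖| ≤ C) (z : CSpace d) :
    extremalFunction {z | totalNorm w z = 1} z =
      ((s * Real.arcosh (totalNorm w z) : ℝ) : EReal) := by
  refine le_antisymm (iSup₂_le fun u hu => ?_) ?_
  · obtain ⟨⟨hpsh, C', hC'⟩, hu0⟩ := hu
    have htop : Tendsto (fun z => Real.arcosh (totalNorm w z)) (Bornology.cobounded (CSpace d))
        atTop := by
      have h1 : Tendsto (fun z : CSpace d => s⁻¹ * (Real.log ‖z‖ - C)) (Bornology.cobounded _)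
          atTop :=
        (tendsto_atTop_add_const_right _ (-C)
          (Real.tendsto_log_atTop.comp tendsto_norm_cobounded_atTop)).const_mul_atTop
          (inv_pos.2 hs)
      refine tendsto_atTop_mono' _ ?_ h1
      filter_upwards [hC] with z hz
      rw [inv_mul_le_iff₀ hs]
      linarith [(abs_le.1 hz).1]
    have hb : ∀ᶠ z in Bornology.cobounded (CSpace d),
        u z ≤ ((s * Real.arcosh (totalNorm w z) + (C + C') : ℝ) : EReal) := by
      filter_upwards [hC, hC'] with z h1 h2
      refine h2.2.trans (EReal.coe_le_coe_iff.2 ?_)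
      linarith [(abs_le.1 h1).1]
    obtain ⟨b, hb'⟩ := hgen z
    refine hpsh.le_of_eventually_le (W := fun z => s * Real.arcosh (totalNorm w z))
      (continuous_const.mul hw.continuous_arcosh) (b := b) ?_
    filter_upwards [hb'] with t ht
    exact hw.le_mul_arcosh_of_ne_zero hec hele heq hleaf hpsh (fun z hz => hu0 z hz) hb htop
      ht.1 ht.2
  · refine le_iSup₂_of_le (fun z => ((s * Real.arcosh (totalNorm w z) : ℝ) : EReal))
      ⟨⟨hw.isPSH_mul_arcosh hs, C, ?_⟩, fun z hz => ?_⟩ le_rfl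
    · filter_upwards [hC] with z hz
      have := abs_le.1 hz
      exact ⟨EReal.coe_le_coe_iff.2 (by linarith), EReal.coe_le_coe_iff.2 (by linarith)⟩
    · simp [show totalNorm w z = 1 from hz]

end IsQuadraticPartition

end Domination

/-! ### The triangle and the quarter disks. -/

theorem eventually_quadratic_ne_zero {x y z : ℂ} (h : y ≠ 0 ∨ z ≠ 0) :
    ∀ᶠ t : ℂ in 𝓝[≠] 0, x + y * t + z * t ^ 2 ≠ 0 := by
  set p : Polynomial ℂ := Polynomial.C x + Polynomial.C y * Polynomial.X +
    Polynomial.C z * Polynomial.X ^ 2 with hp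
  have hp0 : p ≠ 0 := by
    intro h0
    have h1 : p.coeff 1 = y := by simp [hp, Polynomial.coeff_C]
    have h2 : p.coeff 2 = z := by simp [hp]
    rw [h0] at h1 h2
    rcases h with h | h
    · exact h h1.symm
    · exact h h2.symm
  have hfin : {t : ℂ | p.IsRoot t}.Finite := Polynomial.finite_setOfPred_isRoot hp0
  have h1 : ({t : ℂ | p.IsRoot t} \ {0})ᶜ ∈ 𝓝 (0 : ℂ) :=
    (hfin.sdiff).isClosed.isOpen_compl.mem_nhds (by simp)
  filter_upwards [mem_nhdsWithin_of_mem_nhds h1, self_mem_nhdsWithin] with t ht ht0 h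
  refine ht ⟨?_, ht0⟩
  simp [Polynomial.IsRoot, hp, h]

theorem CSpace.norm_sq_eq (z : CSpace 2) : ‖z‖ ^ 2 = ‖z 0‖ ^ 2 + ‖z 1‖ ^ 2 := by
  rw [EuclideanSpace.norm_sq_eq, Fin.sum_univ_two]

/-- The barycentric coordinates of the standard triangle. -/
noncomputable def trianglePartition : Fin 3 → CSpace 2 → ℂ :=
  ![fun z => z 0, fun z => z 1, fun z => 1 - z 0 - z 1]

/-- The pullback of `trianglePartition` by `mapG`. -/
noncomputable def quarterDisksPartition : Fin 3 → CSpace 2 → ℂ :=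
  ![fun z => (z 0 - z 1) ^ 2, fun z => 2 * z 0 * z 1, fun z => 1 - z 0 ^ 2 - z 1 ^ 2]

theorem isQuadraticPartition_triangle : IsQuadraticPartition trianglePartition where
  continuous j := by fin_cases j <;> simp [trianglePartition] <;> fun_prop
  sum_eq_one z := by simp [trianglePartition, Fin.sum_univ_three]
  quadratic z b := by
    refine ⟨![b 0, b 1, -b 0 - b 1], 0, fun j t => ?_⟩
    fin_cases j <;> simp [trianglePartition] <;> ring

theorem isQuadraticPartition_quarterDisks : IsQuadraticPartition quarterDisksPartition where
  continuous j := by fin_cases j <;> simp [quarterDisksPartition] <;> fun_prop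
  sum_eq_one z := by simp [quarterDisksPartition, Fin.sum_univ_three]; ring
  quadratic z b := by
    refine ⟨![2 * (z 0 - z 1) * (b 0 - b 1), 2 * (z 0 * b 1 + z 1 * b 0),
      -2 * (z 0 * b 0 + z 1 * b 1)], ![(b 0 - b 1) ^ 2, 2 * b 0 * b 1, - b 0 ^ 2 - b 1 ^ 2],
      fun j t => ?_⟩
    fin_cases j <;> simp [quarterDisksPartition] <;> ring

theorem totalNorm_triangle (z : CSpace 2) :
    totalNorm trianglePartition z = ‖z 0‖ + ‖z 1‖ + ‖1 - z 0 - z 1‖ := by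
  simp [totalNorm, trianglePartition, Fin.sum_univ_three]

theorem totalNorm_quarterDisks (z : CSpace 2) :
    totalNorm quarterDisksPartition z = formulaArg z := by
  simp [totalNorm, quarterDisksPartition, Fin.sum_univ_three, formulaArg]
  ring

theorem totalNorm_triangle_mapG (z : CSpace 2) :
    totalNorm trianglePartition (mapG z) = formulaArg z := by
  rw [totalNorm_triangle, formulaArg]
  have : 1 - mapG z 0 - mapG z 1 = 1 - z 0 ^ 2 - z 1 ^ 2 := by simp [mapG]; ring
  rw [this]
  simp [mapG]
  ring

theorem abs_arcosh_sub_log_le {x y c : ℝ} (hy : 1 ≤ y) (h1 : y ≤ x) (h2 : x ≤ c * y) (hc : 0 < c) :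
    |Real.arcosh x - Real.log y| ≤ Real.log (2 * c) := by
  have hx : 1 ≤ x := hy.trans h1
  have hs : Real.sqrt (x ^ 2 - 1) ≤ x := by
    rw [Real.sqrt_le_left (by linarith)]; linarith
  have hs0 := Real.sqrt_nonneg (x ^ 2 - 1)
  have h3 : Real.log y ≤ Real.arcosh x := Real.log_le_log (by linarith) (by linarith)
  have h4 : Real.arcosh x ≤ Real.log (2 * c * y) := Real.log_le_log (by linarith) (by linarith)
  rw [Real.log_mul (by positivity) (by positivity)] at h4
  rw [abs_of_nonneg (by linarith)]
  linarith

theorem extremalFunction_triangle (z : CSpace 2) :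
    extremalFunction {z | totalNorm trianglePartition z = 1} z =
      ((Real.arcosh (totalNorm trianglePartition z) : ℝ) : EReal) := by
  have h := isQuadraticPartition_triangle.extremalFunction_eq one_pos
    (e := fun _ => 1) continuous_const
    (fun z => by simpa using isQuadraticPartition_triangle.one_le_totalNorm z)
    (fun z b => ⟨0, 0, by simp⟩) (fun z hz _ => ?_) (fun z => ?_) (C := Real.log (2 * 5)) ?_ z
  · simpa using h
  · set φ : ℂ := (totalNorm trianglePartition z : ℂ) with hφ
    have hφ' : φ = ‖z 0‖ + ‖z 1‖ + ‖1 - z 0 - z 1‖ := by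
      rw [hφ, totalNorm_triangle]; push_cast; rfl
    -- The coordinates are affine, so the first two velocities are b itself; the third follows
    -- because all velocities sum to 0.
    refine ⟨!₂[φ * z 0 - ‖z 0‖, φ * z 1 - ‖z 1‖], 0, fun j t => ?_⟩
    fin_cases j
    · simp [trianglePartition]; ring
    · simp [trianglePartition]; ring
    · simp [trianglePartition]; linear_combination -t * hφ'
  · refine ⟨!₂[1, 2], ?_⟩
    have h1 := eventually_quadratic_ne_zero (x := z 0) (y := 1) (z := 0) (by simp)
    have h2 := eventually_quadratic_ne_zero (x := z 1) (y := 2) (z := 0) (by simp)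
    have h3 := eventually_quadratic_ne_zero (x := 1 - z 0 - z 1) (y := -3) (z := 0) (by simp)
    filter_upwards [h1, h2, h3] with t h1 h2 h3
    refine ⟨fun j => ?_, one_ne_zero⟩
    fin_cases j
    · convert h1 using 1; simp [trianglePartition]
    · convert h2 using 1; simp [trianglePartition]; ring
    · convert h3 using 1; simp [trianglePartition]; ring
  · filter_upwards [tendsto_norm_cobounded_atTop.eventually_ge_atTop 1] with z hz
    rw [one_mul]
    have hsq := CSpace.norm_sq_eq z
    have n0 := norm_nonneg (z 0)
    have n1 := norm_nonneg (z 1)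
    -- The factor 5 comes from φ ≤ 1 + 2|z 0| + 2|z 1| ≤ 5|z| for |z| ≥ 1.
    refine abs_arcosh_sub_log_le hz ?_ ?_ (by norm_num) <;> rw [totalNorm_triangle]
    · have := norm_nonneg (1 - z 0 - z 1)
      have : ‖z‖ ≤ ‖z 0‖ + ‖z 1‖ := by
        refine abs_le_of_sq_le_sq' ?_ (by positivity) |>.2
        nlinarith
      linarith
    · have h1 : ‖1 - z 0 - z 1‖ ≤ 1 + ‖z 0‖ + ‖z 1‖ := by
        refine (norm_sub_le _ _).trans ?_
        have := norm_sub_le 1 (z 0)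
        rw [norm_one] at this
        linarith
      have h2 : ‖z 0‖ ≤ ‖z‖ := PiLp.norm_apply_le z 0
      have h3 : ‖z 1‖ ≤ ‖z‖ := PiLp.norm_apply_le z 1
      linarith

theorem norm_sq_le_norm_sub_sq_add (a b : ℂ) : ‖a‖ ^ 2 + ‖b‖ ^ 2 ≤ ‖a - b‖ ^ 2 + 2 * ‖a * b‖ := by
  have h := abs_le.1 (abs_norm_sub_norm_le a b)
  rw [norm_mul]
  nlinarith [h.1, h.2, norm_nonneg (a - b)]

theorem extremalFunction_quarterDisks (z : CSpace 2) :
    extremalFunction {z | totalNorm quarterDisksPartition z = 1} z =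
      ((1 / 2 * Real.arcosh (formulaArg z) : ℝ) : EReal) := by
  have h := isQuadraticPartition_quarterDisks.extremalFunction_eq one_half_pos
    -- The Jacobian of G is 4 (z 0 - z 1)(z 0 + z 1). The first factor already vanishes only with a
    -- member of the partition; `e` excludes the zeros of the second, and the 1/2 keeps |e| ≤ φ.
    (e := fun z => (z 0 + z 1) ^ 2 / 2) (by fun_prop) (fun z => ?_) (fun z b => ?_)
    (fun z hz hez => ?_) (fun z => ?_) (C := 1 / 2 * Real.log (2 * 5)) ?_ z
  · rwa [totalNorm_quarterDisks] at h
  · rw [totalNorm_quarterDisks, formulaArg]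
    have e1 : (z 0 + z 1) ^ 2 / 2 = (z 0 - z 1) ^ 2 / 2 + 2 * (z 0 * z 1) := by ring
    have e2 := norm_add_le ((z 0 - z 1) ^ 2 / 2) (2 * (z 0 * z 1))
    rw [e1]
    rw [norm_div, norm_pow, norm_mul 2, RCLike.norm_ofNat] at e2
    have := norm_nonneg (1 - z 0 ^ 2 - z 1 ^ 2)
    nlinarith [sq_nonneg ‖z 0 - z 1‖]
  · refine ⟨(z 0 + z 1) * (b 0 + b 1), (b 0 + b 1) ^ 2 / 2, fun t => ?_⟩
    simp
    ring
  · set φ : ℂ := (totalNorm quarterDisksPartition z : ℂ) with hφ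
    have hφ' : φ = ‖(z 0 - z 1) ^ 2‖ + ‖2 * z 0 * z 1‖ + ‖1 - z 0 ^ 2 - z 1 ^ 2‖ := by
      simp [hφ, totalNorm, quarterDisksPartition, Fin.sum_univ_three]
    have hp : z 0 - z 1 ≠ 0 := by
      simpa [quarterDisksPartition] using hz 0
    have hq : z 0 + z 1 ≠ 0 := by
      simpa using hez
    set β₀ : ℂ := φ * (z 0 - z 1) ^ 2 - ‖(z 0 - z 1) ^ 2‖ with hβ₀
    set β₁ : ℂ := φ * (2 * z 0 * z 1) - ‖2 * z 0 * z 1‖ with hβ₁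
    have hβ₂ : φ * (1 - z 0 ^ 2 - z 1 ^ 2) - ‖1 - z 0 ^ 2 - z 1 ^ 2‖ = -β₀ - β₁ := by
      rw [hβ₀, hβ₁]; linear_combination hφ'
    -- The leaf direction of the triangle is lifted through dG, which is diagonal in the coordinates
    -- z 0 ∓ z 1: the equations are the derivatives of (z 0 - z 1)² and of (z 0 + z 1)² = (z 0 - z
    -- 1)² + 2 (2 z 0 z 1).
    obtain ⟨b, h1, h2⟩ : ∃ b : CSpace 2, 2 * (z 0 - z 1) * (b 0 - b 1) = β₀ ∧
        2 * (z 0 + z 1) * (b 0 + b 1) = β₀ + 2 * β₁ := by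
      refine ⟨!₂[((β₀ + 2 * β₁) / (2 * (z 0 + z 1)) + β₀ / (2 * (z 0 - z 1))) / 2,
        ((β₀ + 2 * β₁) / (2 * (z 0 + z 1)) - β₀ / (2 * (z 0 - z 1))) / 2], ?_, ?_⟩ <;>
      · simp
        field_simp
        ring
    refine ⟨b, ![(b 0 - b 1) ^ 2, 2 * b 0 * b 1, - b 0 ^ 2 - b 1 ^ 2], fun j t => ?_⟩
    fin_cases j
    · change (z 0 + t * b 0 - (z 1 + t * b 1)) ^ 2 =
        (z 0 - z 1) ^ 2 + β₀ * t + (b 0 - b 1) ^ 2 * t ^ 2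
      linear_combination t * h1
    · change 2 * (z 0 + t * b 0) * (z 1 + t * b 1) =
        2 * z 0 * z 1 + β₁ * t + 2 * b 0 * b 1 * t ^ 2
      linear_combination t * (h2 - h1) / 2
    · change 1 - (z 0 + t * b 0) ^ 2 - (z 1 + t * b 1) ^ 2 = 1 - z 0 ^ 2 - z 1 ^ 2 +
        (φ * (1 - z 0 ^ 2 - z 1 ^ 2) - ‖1 - z 0 ^ 2 - z 1 ^ 2‖) * t +
        (- b 0 ^ 2 - b 1 ^ 2) * t ^ 2
      rw [hβ₂]
      linear_combination -t * (h1 + h2) / 2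
  -- In the direction (1, 2) all four t² coefficients 1, 4, -5, 9/2 are nonzero, whatever z is.
  · refine ⟨!₂[1, 2], ?_⟩
    have h1 := eventually_quadratic_ne_zero (x := (z 0 - z 1) ^ 2) (y := -2 * (z 0 - z 1))
      (z := 1) (by simp)
    have h2 := eventually_quadratic_ne_zero (x := 2 * z 0 * z 1) (y := 4 * z 0 + 2 * z 1)
      (z := 4) (by simp)
    have h3 := eventually_quadratic_ne_zero (x := 1 - z 0 ^ 2 - z 1 ^ 2)
      (y := -2 * z 0 - 4 * z 1) (z := -5) (by simp)
    have h4 := eventually_quadratic_ne_zero (x := (z 0 + z 1) ^ 2 / 2) (y := 3 * (z 0 + z 1))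
      (z := 9 / 2) (by simp)
    filter_upwards [h1, h2, h3, h4] with t h1 h2 h3 h4
    refine ⟨fun j => ?_, ?_⟩
    · fin_cases j
      · convert h1 using 1; simp [quarterDisksPartition]; ring
      · convert h2 using 1; simp [quarterDisksPartition]; ring
      · convert h3 using 1; simp [quarterDisksPartition]; ring
    · convert h4 using 1; simp; ring
  · filter_upwards [tendsto_norm_cobounded_atTop.eventually_ge_atTop 1] with z hz
    have hsq := CSpace.norm_sq_eq z
    have h0 := norm_sq_le_norm_sub_sq_add (z 0) (z 1)
    have n := norm_nonneg (1 - z 0 ^ 2 - z 1 ^ 2)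
    have h1 : |Real.arcosh (totalNorm quarterDisksPartition z) - Real.log (‖z‖ ^ 2)| ≤
        Real.log (2 * 5) := by
      refine abs_arcosh_sub_log_le (one_le_pow₀ hz) ?_ ?_ (by norm_num) <;>
        rw [totalNorm_quarterDisks, formulaArg]
      · linarith
      · have h1 : ‖1 - z 0 ^ 2 - z 1 ^ 2‖ ≤ 1 + ‖z 0‖ ^ 2 + ‖z 1‖ ^ 2 := by
          refine (norm_sub_le _ _).trans ?_
          have := norm_sub_le 1 (z 0 ^ 2)
          rw [norm_one, norm_pow] at this
          rw [norm_pow]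
          linarith
        have h2 := norm_sub_le (z 0) (z 1)
        have h3 : 1 ≤ ‖z‖ ^ 2 := one_le_pow₀ hz
        rw [norm_mul]
        nlinarith [sq_nonneg (‖z 0‖ - ‖z 1‖), norm_nonneg (z 0 - z 1)]
    rw [Real.log_pow] at h1
    generalize Real.log (2 * 5) = c at h1 ⊢
    rw [abs_le] at h1 ⊢
    push_cast at h1
    constructor <;> linarith

/-! ### The sets {φ = 1} and the map G. -/

/-- The equality case of the triangle inequality: the terms |w j| - Re (w j) are nonnegative and sum
to φ - 1. -/
theorem totalNorm_eq_one_iff {d : ℕ} {ι : Type*} [Fintype ι] {w : ι → CSpace d → ℂ}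
    (hw : IsQuadraticPartition w) (z : CSpace d) :
    totalNorm w z = 1 ↔ ∀ j, ∃ x : ℝ, 0 ≤ x ∧ w j z = x := by
  constructor
  · intro h j
    have h1 : ∑ j, (‖w j z‖ - (w j z).re) = 0 := by
      rw [Finset.sum_sub_distrib, ← Complex.re_sum, hw.sum_eq_one, Complex.one_re]
      exact sub_eq_zero.2 h
    have h2 := (Finset.sum_eq_zero_iff_of_nonneg fun j _ =>
      sub_nonneg.2 (Complex.re_le_norm (w j z))).1 h1 j (Finset.mem_univ j)
    refine ⟨‖w j z‖, norm_nonneg _, ?_⟩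
    have h3 : (w j z).im = 0 := Complex.abs_re_eq_norm.1 (by
      rw [abs_of_nonneg] <;> linarith [norm_nonneg (w j z)])
    apply Complex.ext
    · rw [Complex.ofReal_re]; linarith
    · rw [Complex.ofReal_im, h3]
  · intro h
    have h1 : ∀ j, (‖w j z‖ : ℂ) = w j z := by
      intro j
      obtain ⟨x, hx, h⟩ := h j
      rw [h, Complex.norm_real, Real.norm_eq_abs, abs_of_nonneg hx]
    have h2 : ((totalNorm w z : ℝ) : ℂ) = 1 := by
      rw [totalNorm, Complex.ofReal_sum, Finset.sum_congr rfl fun j _ => h1 j, hw.sum_eq_one]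
    exact_mod_cast h2

theorem convexHull_triangle :
    convexHull ℝ {!₂[(0 : ℝ), 0], !₂[(0 : ℝ), 1], !₂[(1 : ℝ), 0]} =
      {x : EuclideanSpace ℝ (Fin 2) | 0 ≤ x 0 ∧ 0 ≤ x 1 ∧ x 0 + x 1 ≤ 1} := by
  refine subset_antisymm (convexHull_min ?_ ?_) fun x hx => ?_
  · rintro x (rfl | rfl | rfl) <;> simp
  · rintro x ⟨hx0, hx1, hx⟩ y ⟨hy0, hy1, hy⟩ a b ha hb hab
    refine ⟨?_, ?_, ?_⟩
    · simp only [PiLp.add_apply, PiLp.smul_apply, smul_eq_mul]; positivity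
    · simp only [PiLp.add_apply, PiLp.smul_apply, smul_eq_mul]; positivity
    · simp only [PiLp.add_apply, PiLp.smul_apply, smul_eq_mul]
      nlinarith
  · obtain ⟨h0, h1, h2⟩ := hx
    have h := (convex_convexHull ℝ {!₂[(0 : ℝ), 0], !₂[(0 : ℝ), 1], !₂[(1 : ℝ), 0]}).sum_mem
      (t := Finset.univ) (w := ![1 - x 0 - x 1, x 1, x 0])
      (z := ![!₂[(0 : ℝ), 0], !₂[(0 : ℝ), 1], !₂[(1 : ℝ), 0]])
      (fun i _ => by fin_cases i <;> simp <;> linarith)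
      (by simp [Fin.sum_univ_three])
      (fun i _ => subset_convexHull ℝ _ (by fin_cases i <;> simp))
    convert h using 1
    ext i
    fin_cases i <;> simp [Fin.sum_univ_three]

theorem standardTriangle_eq :
    standardTriangle = {z | totalNorm trianglePartition z = 1} := by
  ext z
  rw [Set.mem_ofPred_eq, totalNorm_eq_one_iff isQuadraticPartition_triangle, standardTriangle,
    convexHull_triangle]
  constructor
  · rintro ⟨x, ⟨h0, h1, h2⟩, rfl⟩ j
    fin_cases j
    · exact ⟨x 0, h0, by simp [trianglePartition, realInclusion]⟩
    · exact ⟨x 1, h1, by simp [trianglePartition, realInclusion]⟩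
    · exact ⟨1 - x 0 - x 1, by linarith, by simp [trianglePartition, realInclusion]⟩
  · intro h
    obtain ⟨x, hx, h0⟩ := h 0
    obtain ⟨y, hy, h1⟩ := h 1
    obtain ⟨c, hc, h2⟩ := h 2
    simp [trianglePartition] at h0 h1 h2
    rw [h0, h1] at h2
    have h2' : 1 - x - y = c := by exact_mod_cast h2
    refine ⟨!₂[x, y], ⟨hx, hy, ?_⟩, ?_⟩
    · simp; linarith
    · ext j; fin_cases j <;> simp [realInclusion, h0, h1]

theorem exists_real_of_sq {a : ℂ} {x : ℝ} (hx : 0 ≤ x) (h : a ^ 2 = x) : ∃ y : ℝ, a = y := by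
  have h1 : a ^ 2 = ((Real.sqrt x : ℝ) : ℂ) ^ 2 := by
    rw [h, ← Complex.ofReal_pow, Real.sq_sqrt hx]
  rcases sq_eq_sq_iff_eq_or_eq_neg.1 h1 with h | h
  · exact ⟨_, h⟩
  · exact ⟨-Real.sqrt x, by rw [h]; push_cast; rfl⟩

theorem quarterDisks_eq :
    quarterDisks = {z | totalNorm quarterDisksPartition z = 1} := by
  ext z
  rw [Set.mem_ofPred_eq, totalNorm_eq_one_iff isQuadraticPartition_quarterDisks, quarterDisks]
  constructor
  · rintro ⟨x, ⟨h0, h1⟩, rfl⟩ j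
    fin_cases j
    · exact ⟨(x 0 - x 1) ^ 2, sq_nonneg _, by simp [quarterDisksPartition, realInclusion]⟩
    · exact ⟨2 * x 0 * x 1, by linarith, by simp [quarterDisksPartition, realInclusion]⟩
    · exact ⟨1 - x 0 ^ 2 - x 1 ^ 2, by linarith, by simp [quarterDisksPartition, realInclusion]⟩
  · intro h
    obtain ⟨x, hx, h0⟩ := h 0
    obtain ⟨y, hy, h1⟩ := h 1
    obtain ⟨c, hc, h2⟩ := h 2
    simp [quarterDisksPartition] at h0 h1 h2
    obtain ⟨p, hp⟩ := exists_real_of_sq hx h0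
    -- Both z 0 - z 1 and z 0 + z 1 have nonnegative real squares, so they are real, and hence so is
    -- z.
    obtain ⟨q, hq⟩ := exists_real_of_sq (a := z 0 + z 1) (x := x + 2 * y) (by linarith)
      (by push_cast; linear_combination h0 + 2 * h1)
    have e0 : z 0 = (((q + p) / 2 : ℝ) : ℂ) := by push_cast; linear_combination (hp + hq) / 2
    have e1 : z 1 = (((q - p) / 2 : ℝ) : ℂ) := by push_cast; linear_combination (hq - hp) / 2
    rw [e0, e1] at h1 h2
    have h1' : 2 * ((q + p) / 2) * ((q - p) / 2) = y := by exact_mod_cast h1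
    have h2' : 1 - ((q + p) / 2) ^ 2 - ((q - p) / 2) ^ 2 = c := by exact_mod_cast h2
    refine ⟨!₂[(q + p) / 2, (q - p) / 2], ⟨?_, ?_⟩, ?_⟩
    · simp; linarith
    · simp; linarith
    · ext j; fin_cases j <;> simp [realInclusion, e0, e1]

/-- Properness follows from |G(z)| ≥ |z|²/2. -/
theorem isProperMap_mapG : IsProperMap mapG := by
  rw [isProperMap_iff_tendsto_cocompact, ← Metric.cobounded_eq_cocompact]
  refine ⟨?_, ?_⟩
  · unfold mapG; fun_prop
  · rw [← tendsto_norm_atTop_iff_cobounded]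
    have h1 : Tendsto (fun z : CSpace 2 => ‖z‖ ^ 2 / 2) (Bornology.cobounded _) atTop :=
      ((tendsto_pow_atTop two_ne_zero).comp tendsto_norm_cobounded_atTop).atTop_div_const two_pos
    refine tendsto_atTop_mono (fun z => ?_) h1
    have h0 := norm_sq_le_norm_sub_sq_add (z 0) (z 1)
    have h2 : ‖mapG z 0‖ ≤ ‖mapG z‖ := PiLp.norm_apply_le _ 0
    have h3 : ‖mapG z 1‖ ≤ ‖mapG z‖ := PiLp.norm_apply_le _ 1
    have e2 : ‖mapG z 0‖ = ‖z 0 - z 1‖ ^ 2 := by simp [mapG]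
    have e3 : ‖mapG z 1‖ = 2 * ‖z 0 * z 1‖ := by simp [mapG, mul_assoc]
    rw [CSpace.norm_sq_eq]
    linarith

end Pluripotential

theorem mainTheorem2 :
    (∀ z : Pluripotential.CSpace 2,
      1 ≤ Pluripotential.formulaArg z ∧
      Pluripotential.extremalFunction Pluripotential.quarterDisks z =
        ((1 / 2 * Real.log (Pluripotential.joukowski (Pluripotential.formulaArg z)) : ℝ) : EReal)) ∧
    IsProperMap Pluripotential.mapG ∧
    Pluripotential.mapG ⁻¹' Pluripotential.standardTriangle = Pluripotential.quarterDisks ∧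
    (∀ z : Pluripotential.CSpace 2,
      Pluripotential.extremalFunction Pluripotential.standardTriangle (Pluripotential.mapG z) =
        2 * Pluripotential.extremalFunction Pluripotential.quarterDisks z) := by
  open Pluripotential in
  refine ⟨fun z => ⟨?_, ?_⟩, isProperMap_mapG, ?_, fun z => ?_⟩
  · rw [← totalNorm_quarterDisks]
    exact isQuadraticPartition_quarterDisks.one_le_totalNorm z
  · rw [quarterDisks_eq]
    -- `Real.arcosh` unfolds to the logarithm of the Joukowski map.
    exact extremalFunction_quarterDisks z
  · ext z
    simp [quarterDisks_eq, standardTriangle_eq, totalNorm_triangle_mapG, totalNorm_quarterDisks]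
  · rw [quarterDisks_eq, standardTriangle_eq, extremalFunction_quarterDisks,
      extremalFunction_triangle, totalNorm_triangle_mapG,
      show (2 : EReal) = ((2 : ℝ) : EReal) from rfl, ← EReal.coe_mul]
    congr 1
    ring
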